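/- Let $d\ge 1$, let $K\subset\mathbb{R}^d$ be a closed non-degenerate $d$-simplex, let $\gamma$ be one of its facets, let $h_K$ be the diameter of $K$, and let $\kappa_K\ge 0$ be a constant. Write $|K|$ for the $d$-dimensional volume of $K$ and $|\gamma|$ for the $(d-1)$-dimensional measure of $\gamma$ (the counting measure if $d=1$). For $v\in H^1(K)$ put $$|\!|\!|v|\!|\!|_K=\Big(\int_K\big(|\nabla v|^2+\kappa_K^2v^2\big)\,dx\Big)^{1/2},$$ let $\|\cdot\|_\gamma$ be the norm of $L^2(\gamma)$, and let $\bar v_\gamma=|\gamma|^{-1}\int_\gamma v\,ds$, where the values of $v$ on $\gamma$ are those of its trace: the unique element of $L^2(\gamma)$ which is the limit of $u_n|_\gamma$ for some functions $u_n\in C^\infty(\mathbb{R}^d)$ that converge to $v$ in $H^1(K)$ (it exists for every $v\in H^1(K)$). Let $m=\min\{h_K/\pi,\kappa_K^{-1}\}$, where $m=h_K/\pi$ if $\kappa_K=0$. Define $C_T>0$ (for $\kappa_K>0$) and $\overline{C}_T>0$ by $$C_T^2=\frac{|\gamma|}{d|K|}\,\frac1{\kappa_K}\sqrt{(2h_K)^2+(d/\kappa_K)^2},\qquad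 \overline{C}_T^2=\frac{|\gamma|}{d|K|}\,m\,(2h_K+d\,m).$$ Then every $v\in H^1(K)$ satisfies $$\|v\|_\gamma\le C_T\,|\!|\!|v|\!|\!|_K\quad\text{if }\kappa_K>0,\qquad\text{and}\qquad \|v-\bar v_\gamma\|_\gamma\le\overline{C}_T\,|\!|\!|v|\!|\!|_K\quad\text{for all }\kappa_K\ge 0.$$ -/

import Mathlib

open MeasureTheory Filter Topology
open scoped ContDiff Gradient

noncomputable section

namespace SimplexTrace

/-- Euclidean space of dimension `d`. -/
abbrev E (d : ℕ) : Type := EuclideanSpace ℝ (Fin d)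

/-- `v ∈ H¹(Ω)` with weak gradient `G`: both are square integrable on the open set `Ω`, and
`∫_Ω v ∂_e φ = - ∫_Ω (G · e) φ` for all test functions `φ ∈ C_c^∞(Ω)` and all directions `e`. -/
structure IsH1 {d : ℕ} (Ω : Set (E d)) (v : E d → ℝ) (G : E d → E d) : Prop where
  memLp : MemLp v 2 (volume.restrict Ω)
  memLp_grad : MemLp G 2 (volume.restrict Ω)
  integral_eq : ∀ φ : E d → ℝ, ContDiff ℝ ∞ φ → HasCompactSupport φ → tsupport φ ⊆ Ω →
    ∀ e : E d, ∫ x in Ω, v x * fderiv ℝ φ x e = - ∫ x in Ω, inner ℝ (G x) e * φ x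

/-- The `(d-1)`-dimensional surface measure on a subset `γ` of a hyperplane of `ℝ^d`. -/
def surface {d : ℕ} (γ : Set (E d)) : Measure (E d) :=
  (Measure.euclideanHausdorffMeasure (d - 1)).restrict γ

/-- `g ∈ L²(γ)` is the trace on `γ` of the function `v ∈ H¹(Ω)` with weak gradient `G`:
it is the limit in `L²(γ)` of the restrictions to `γ` of functions that are smooth up to the
boundary and converge to `v` in `H¹(Ω)`. -/
def IsTrace {d : ℕ} (Ω γ : Set (E d)) (v : E d → ℝ) (G : E d → E d) (g : E d → ℝ) : Prop :=
  MemLp g 2 (surface γ) ∧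
  ∃ u : ℕ → E d → ℝ, (∀ n, ContDiff ℝ ∞ (u n)) ∧
    Tendsto (fun n => eLpNorm (fun x => u n x - v x) 2 (volume.restrict Ω)) atTop (𝓝 0) ∧
    Tendsto (fun n => eLpNorm (fun x => ∇ (u n) x - G x) 2 (volume.restrict Ω)) atTop (𝓝 0) ∧
    Tendsto (fun n => eLpNorm (fun x => u n x - g x) 2 (surface γ)) atTop (𝓝 0)

/-- The norm of `L²(μ)`. -/
def l2norm {d : ℕ} (μ : Measure (E d)) (g : E d → ℝ) : ℝ := √(∫ x, g x ^ 2 ∂μ)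

/-- The local energy norm `(∫_Ω |∇v|² + κ² v²)^{1/2}`, where `G = ∇v`. -/
def energyNorm {d : ℕ} (Ω : Set (E d)) (κ : ℝ) (v : E d → ℝ) (G : E d → E d) : ℝ :=
  √(∫ x in Ω, (‖G x‖ ^ 2 + κ ^ 2 * v x ^ 2))

/-- The closed simplex spanned by the vertices. -/
abbrev body {d : ℕ} (s : Affine.Simplex ℝ (E d) d) : Set (E d) := s.closedInterior

/-- The facet opposite to the vertex with index `i`. -/
abbrev facet {d : ℕ} [NeZero d] (s : Affine.Simplex ℝ (E d) d) (i : Fin (d + 1)) : Set (E d) :=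
  (s.faceOpposite i).closedInterior

/-- The volume `|K|`. -/
def vol {d : ℕ} (s : Affine.Simplex ℝ (E d) d) : ℝ := (volume (body s)).toReal

/-- The facet area `|γ|`. -/
def area {d : ℕ} [NeZero d] (s : Affine.Simplex ℝ (E d) d) (i : Fin (d + 1)) : ℝ :=
  (surface (facet s i) Set.univ).toReal

/-- The diameter `h_K`. -/
def diam {d : ℕ} (s : Affine.Simplex ℝ (E d) d) : ℝ := Metric.diam (body s)

/-- The minimum of `h / π` and `1 / κ`, where `1 / κ` is `+∞` for `κ = 0`. -/
def minScale (h κ : ℝ) : ℝ := if κ = 0 then h / Real.pi else min (h / Real.pi) (1 / κ)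

/-- The constant `C_T`. -/
def constT {d : ℕ} [NeZero d] (s : Affine.Simplex ℝ (E d) d) (i : Fin (d + 1)) (κ : ℝ) : ℝ :=
  √(area s i / (d * vol s) * (1 / κ) * √((2 * diam s) ^ 2 + (d / κ) ^ 2))

/-- The constant `C̄_T`. -/
def constTBar {d : ℕ} [NeZero d] (s : Affine.Simplex ℝ (E d) d) (i : Fin (d + 1)) (κ : ℝ) : ℝ :=
  √(area s i / (d * vol s) * minScale (diam s) κ * (2 * diam s + d * minScale (diam s) κ))

end SimplexTrace

end

noncomputable section

namespace SimplexTrace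

/-! ### Variance inequalities -/

/-! Let `p` be the vertex opposite the facet γ, and write everything with mean values over K and γ.
Integration along the rays from `p` gives the trace identity: the mean of f over γ equals the mean
over K of f + ∇f·(x - p)/d (`integral_facet_eq`). With f = u², |x - p| ≤ h and Young's inequality
with a free parameter s, this becomes `integral_facet_sq_le`; both bounds come from it by a choice
of s. The bound with C_T is then algebra. For the mean-free bound it is applied to u - c, with c the
mean of u over K, because no constant is closer to u on γ than its facet mean. The variance of u
over K is at most m² times the mean energy density: for m = 1/κ this is trivial, for m = h/π it is a
Poincaré inequality.

That inequality is needed only for d ≥ 2, since for d = 1 the facet is a point. In conical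
coordinates the uniform law of a simplex is the product of a power law on [0,1] and the uniform law
of a facet. The Efron–Stein inequality (`variance_prod_le`) and a weighted inequality in one
variable (`variance_powerLaw_le`) then bound the variance, by induction, by squared edge derivatives
with weights w_j w_k/(k+1). Averaging over three orderings of the vertices and applying Popoviciu's
inequality gives the constant 7h²/72, which is below h²/π².

For H¹ functions, smooth approximations on the convex interior are averages over copies contracted
towards an interior ball, so no extension across the boundary is needed (`exists_smooth_tendsto`).
The first bound with κ = 1 makes their restrictions to γ a Cauchy sequence and the trace unique;
both bounds pass to the limit. -/

lemma sq_sub_le_sub_mul_sub {f : ℝ → ℝ} (hf : ContDiff ℝ 1 f) (x y : ℝ) :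
    (f x - f y) ^ 2 ≤
      (x - y) * ((∫ z in (0 : ℝ)..x, deriv f z ^ 2) - ∫ z in (0 : ℝ)..y, deriv f z ^ 2) := by
  have hc : Continuous (deriv f) := hf.continuous_deriv le_rfl
  wlog hxy : y < x generalizing x y
  · rcases eq_or_lt_of_le (not_lt.1 hxy) with h | h
    · simp [h]
    · have := this y x h
      nlinarith
  have hi : ∀ a b : ℝ, IntervalIntegrable (fun z => deriv f z ^ 2) volume a b := fun a b =>
    (hc.pow 2).intervalIntegrable a b
  rw [intervalIntegral.integral_interval_sub_left (hi _ _) (hi _ _)]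
  have hF : ∫ z in y..x, deriv f z = f x - f y :=
    intervalIntegral.integral_deriv_eq_sub (fun z _ => (hf.differentiable one_ne_zero) z)
      (hc.intervalIntegrable _ _)
  -- With c the mean of f' on [y, x], expanding 0 ≤ ∫ (f' - c)² is the Cauchy–Schwarz inequality.
  set c := (f x - f y) / (x - y) with hcdef
  have h0 : 0 ≤ ∫ z in y..x, (deriv f z - c) ^ 2 :=
    intervalIntegral.integral_nonneg hxy.le fun _ _ => sq_nonneg _
  have h1 : ∫ z in y..x, (deriv f z - c) ^ 2 =
      (∫ z in y..x, deriv f z ^ 2) - 2 * c * (f x - f y) + c ^ 2 * (x - y) := by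
    have : ∀ z, (deriv f z - c) ^ 2 = deriv f z ^ 2 - 2 * c * deriv f z + c ^ 2 := fun z => by ring
    simp_rw [this]
    rw [intervalIntegral.integral_add, intervalIntegral.integral_sub,
      intervalIntegral.integral_const_mul, hF, intervalIntegral.integral_const, smul_eq_mul]
    · ring
    · exact hi _ _
    · exact (hc.intervalIntegrable _ _).const_mul _
    · exact ((hi _ _).sub ((hc.intervalIntegrable _ _).const_mul _))
    · exact intervalIntegrable_const
  have hpos : 0 < x - y := sub_pos.2 hxy
  have hfc : f x - f y = c * (x - y) := by rw [hcdef]; field_simp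
  rw [hfc] at h1 ⊢
  nlinarith

/-- Integrating the hypothesis over two independent copies gives the claim doubled: the left side
becomes 2 Var f and the right side 2 Cov(X, Q). -/
lemma variance_le_covariance {Ω : Type*} [MeasurableSpace Ω] {μ : Measure Ω} [IsProbabilityMeasure μ]
    {f X Q : Ω → ℝ}
    (h : ∀ x y, (f x - f y) ^ 2 ≤ (X x - X y) * (Q x - Q y))
    (hf : Integrable f μ) (hf2 : Integrable (fun x => f x ^ 2) μ)
    (hx : Integrable X μ) (hQ : Integrable Q μ)
    (hxQ : Integrable (fun x => X x * Q x) μ) :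
    ∫ x, f x ^ 2 ∂μ - (∫ x, f x ∂μ) ^ 2 ≤ ∫ x, X x * Q x ∂μ - (∫ x, X x ∂μ) * ∫ x, Q x ∂μ := by
  set s := ∫ x, f x ^ 2 ∂μ
  set m := ∫ x, f x ∂μ
  set r := ∫ x, X x * Q x ∂μ
  set e := ∫ x, X x ∂μ
  set q := ∫ x, Q x ∂μ
  have h1 : ∀ x, f x ^ 2 - 2 * f x * m + s ≤ X x * Q x - X x * q - Q x * e + r := by
    intro x
    have hL : ∫ y, (f x ^ 2 - 2 * f x * f y + f y ^ 2) ∂μ = f x ^ 2 - 2 * f x * m + s := by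
      rw [integral_add (by fun_prop) hf2, integral_sub (by fun_prop) (by fun_prop),
        integral_const_mul]
      simp [s, m]
    have hR : ∫ y, (X x * Q x - X x * Q y - Q x * X y + X y * Q y) ∂μ =
        X x * Q x - X x * q - Q x * e + r := by
      rw [integral_add (by fun_prop) hxQ, integral_sub (by fun_prop) (by fun_prop),
        integral_sub (by fun_prop) (by fun_prop), integral_const_mul, integral_const_mul]
      simp [q, e, r, integral_const_mul]
    rw [← hL, ← hR]
    refine integral_mono (((integrable_const _).sub (hf.const_mul _)).add hf2)
      ((((integrable_const _).sub (hQ.const_mul _)).sub (hx.const_mul _)).add hxQ) fun y => ?_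
    have := h x y
    simp only
    nlinarith
  have h2 := integral_mono (μ := μ) (f := fun x => f x ^ 2 - 2 * f x * m + s)
    (g := fun x => X x * Q x - X x * q - Q x * e + r)
    ((hf2.sub ((hf.const_mul 2).mul_const m)).add (integrable_const _))
    (((hxQ.sub (hx.mul_const _)).sub (hQ.mul_const _)).add (integrable_const _)) h1
  rw [integral_add (by fun_prop) (by fun_prop), integral_sub hf2 (by fun_prop),
    integral_mul_const, integral_const_mul, integral_add (by fun_prop) (by fun_prop),
    integral_sub (by fun_prop) (by fun_prop), integral_sub hxQ (by fun_prop),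
    integral_mul_const, integral_mul_const] at h2
  simp only [integral_const, probReal_univ, smul_eq_mul, one_mul] at h2
  change s - 2 * m * m + s ≤ r - e * q - q * e + r at h2
  nlinarith

/-- The Efron–Stein inequality for two factors. -/
lemma variance_prod_le {α β : Type*} [MeasurableSpace α] [MeasurableSpace β] {μ : Measure α}
    {ν : Measure β} [IsProbabilityMeasure μ] [IsProbabilityMeasure ν] {H : α × β → ℝ}
    (hH : AEStronglyMeasurable H (μ.prod ν)) {C : ℝ} (hC : ∀ᵐ z ∂μ.prod ν, |H z| ≤ C) :
    ∫ z, H z ^ 2 ∂μ.prod ν - (∫ z, H z ∂μ.prod ν) ^ 2 ≤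
      ∫ x, (∫ y, H (x, y) ^ 2 ∂ν - (∫ y, H (x, y) ∂ν) ^ 2) ∂μ +
      ∫ y, (∫ x, H (x, y) ^ 2 ∂μ - (∫ x, H (x, y) ∂μ) ^ 2) ∂ν := by
  set g : α → ℝ := fun x => ∫ y, H (x, y) ∂ν
  set k : β → ℝ := fun y => ∫ x, H (x, y) ∂μ
  set a := ∫ z, H z ∂μ.prod ν
  have hHi : Integrable H (μ.prod ν) := .of_bound hH C hC
  have hg : AEStronglyMeasurable g μ := hH.integral_prod_right'
  have hk : AEStronglyMeasurable k ν := hH.prod_swap.integral_prod_right'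
  have hgC : ∀ᵐ x ∂μ, |g x| ≤ C := by
    filter_upwards [Measure.ae_ae_of_ae_prod hC] with x hx
    have hx' : ∀ᵐ y ∂ν, ‖H (x, y)‖ ≤ C := hx
    simpa using norm_integral_le_of_norm_le_const hx'
  have hC' : ∀ᵐ z ∂ν.prod μ, |H z.swap| ≤ C :=
    (Measure.measurePreserving_swap (μ := ν) (ν := μ)).quasiMeasurePreserving.ae hC
  have hkC : ∀ᵐ y ∂ν, |k y| ≤ C := by
    filter_upwards [Measure.ae_ae_of_ae_prod hC'] with x hx
    have hx' : ∀ᵐ y ∂μ, ‖H (y, x)‖ ≤ C := hx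
    simpa using norm_integral_le_of_norm_le_const hx'
  have hgz := hg.comp_fst (ν := ν)
  have hkz := hk.comp_snd (μ := μ)
  have hgzC : ∀ᵐ z ∂μ.prod ν, |g z.1| ≤ C :=
    (Measure.quasiMeasurePreserving_fst (μ := μ) (ν := ν)).ae hgC
  have hkzC : ∀ᵐ z ∂μ.prod ν, |k z.2| ≤ C :=
    (Measure.quasiMeasurePreserving_snd (μ := μ) (ν := ν)).ae hkC
  have key : ∀ {u v : α × β → ℝ}, AEStronglyMeasurable u (μ.prod ν) →
      AEStronglyMeasurable v (μ.prod ν) → (∀ᵐ z ∂μ.prod ν, |u z| ≤ C) →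
      (∀ᵐ z ∂μ.prod ν, |v z| ≤ C) → Integrable (fun z => u z * v z) (μ.prod ν) := by
    intro u v hu hv hu' hv'
    refine .of_bound (hu.mul hv) (C * C) ?_
    filter_upwards [hu', hv'] with z h1 h2
    rw [norm_mul]
    exact mul_le_mul h1 h2 (abs_nonneg _) ((abs_nonneg _).trans h1)
  have i1 : ∫ z, H z * g z.1 ∂μ.prod ν = ∫ x, g x ^ 2 ∂μ := by
    rw [integral_prod _ (key hH hgz hC hgzC)]
    simp_rw [integral_mul_const, sq]; rfl
  have i2 : ∫ z, H z * k z.2 ∂μ.prod ν = ∫ y, k y ^ 2 ∂ν := by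
    rw [integral_prod_symm _ (key hH hkz hC hkzC)]
    simp_rw [integral_mul_const, sq]; rfl
  have i3 : ∫ z, g z.1 * g z.1 ∂μ.prod ν = ∫ x, g x ^ 2 ∂μ := by
    rw [integral_prod _ (key hgz hgz hgzC hgzC)]
    simp [sq]
  have i4 : ∫ z, k z.2 * k z.2 ∂μ.prod ν = ∫ y, k y ^ 2 ∂ν := by
    rw [integral_prod_symm _ (key hkz hkz hkzC hkzC)]
    simp [sq]
  have ig : ∫ x, g x ∂μ = a := (integral_prod _ hHi).symm
  have ik : ∫ y, k y ∂ν = a := (integral_prod_symm _ hHi).symm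
  have i5 : ∫ z, g z.1 * k z.2 ∂μ.prod ν = a * a := by
    rw [integral_prod_mul, ig, ik]
  have igz : ∫ z, g z.1 ∂μ.prod ν = a := by rw [integral_fun_fst]; simp [ig]
  have ikz : ∫ z, k z.2 ∂μ.prod ν = a := by rw [integral_fun_snd]; simp [ik]
  have jg : Integrable (fun z : α × β => g z.1) (μ.prod ν) := .of_bound hgz C hgzC
  have jk : Integrable (fun z : α × β => k z.2) (μ.prod ν) := .of_bound hkz C hkzC
  have hHH : Integrable (fun z => H z * H z) (μ.prod ν) := key hH hH hC hC
  -- The integrand is the square of the interaction term in the Hoeffding decomposition of H;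
  -- expanding this square is the whole proof.
  have h0 : 0 ≤ ∫ z, (H z - g z.1 - k z.2 + a) ^ 2 ∂μ.prod ν :=
    integral_nonneg fun _ => sq_nonneg _
  have h1 : ∫ z, (H z - g z.1 - k z.2 + a) ^ 2 ∂μ.prod ν =
      ∫ z, H z * H z ∂μ.prod ν - ∫ x, g x ^ 2 ∂μ - ∫ y, k y ^ 2 ∂ν + a ^ 2 := by
    have : ∀ z : α × β, (H z - g z.1 - k z.2 + a) ^ 2 =
        (H z * H z + g z.1 * g z.1 + k z.2 * k z.2 + a * a + 2 * (g z.1 * k z.2) +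
          2 * a * H z) - (2 * (H z * g z.1) + 2 * (H z * k z.2) + 2 * a * g z.1 + 2 * a * k z.2) :=
      fun z => by ring
    simp_rw [this]
    have k1 := key hgz hgz hgzC hgzC
    have k2 := key hkz hkz hkzC hkzC
    have k3 := (key hgz hkz hgzC hkzC).const_mul 2
    have k4 := hHi.const_mul (2 * a)
    have k5 := (key hH hgz hC hgzC).const_mul 2
    have k6 := (key hH hkz hC hkzC).const_mul 2
    have k7 := jg.const_mul (2 * a)
    have k8 := jk.const_mul (2 * a)
    have k0 : Integrable (fun _ : α × β => a * a) (μ.prod ν) := integrable_const _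
    rw [integral_sub (by fun_prop) (by fun_prop), integral_add (by fun_prop) k4,
      integral_add (by fun_prop) k3, integral_add (by fun_prop) k0,
      integral_add (by fun_prop) k2, integral_add hHH k1,
      integral_add (by fun_prop) k8, integral_add (by fun_prop) k7, integral_add k5 k6]
    simp only [integral_const_mul, i1, i2, i3, i4, i5, igz, ikz, integral_const, probReal_univ,
      smul_eq_mul, one_mul]
    change _ + 2 * a * a - _ = _
    ring
  have hsq : (fun z => H z ^ 2) = fun z => H z * H z := by funext z; ring
  have gsq : Integrable (fun x => g x ^ 2) μ := by
    refine .of_bound (hg.pow 2) (C ^ 2) ?_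
    filter_upwards [hgC] with x hx
    rw [norm_pow]; exact pow_le_pow_left₀ (abs_nonneg _) hx 2
  have ksq : Integrable (fun x => k x ^ 2) ν := by
    refine .of_bound (hk.pow 2) (C ^ 2) ?_
    filter_upwards [hkC] with x hx
    rw [norm_pow]; exact pow_le_pow_left₀ (abs_nonneg _) hx 2
  have hH2 : Integrable (fun z => H z ^ 2) (μ.prod ν) := hsq ▸ hHH
  rw [integral_sub hH2.integral_prod_left gsq, integral_sub hH2.integral_prod_right ksq,
    ← integral_prod _ hH2, ← integral_prod_symm _ hH2, hsq]
  rw [h1] at h0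
  linarith

/-! ### A weighted Poincaré inequality on the unit interval. -/

/-- The law on `[0, 1]` with density `(n + 1) t ^ n`. -/
def powerLaw (n : ℕ) : Measure ℝ :=
  (volume.restrict (Set.Ioc 0 1)).withDensity fun t => ENNReal.ofReal ((n + 1) * t ^ n)

lemma integral_powerLaw (n : ℕ) (f : ℝ → ℝ) :
    ∫ t, f t ∂powerLaw n = ∫ t in (0 : ℝ)..1, (n + 1) * t ^ n * f t := by
  rw [powerLaw, integral_withDensity_eq_integral_toReal_smul (by fun_prop) (by simp),
    intervalIntegral.integral_of_le zero_le_one]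
  refine setIntegral_congr_fun measurableSet_Ioc fun t ht => ?_
  have : 0 ≤ ((n : ℝ) + 1) * t ^ n := by have := ht.1.le; positivity
  simp [ENNReal.toReal_ofReal this]

instance (n : ℕ) : IsProbabilityMeasure (powerLaw n) := by
  constructor
  rw [powerLaw, withDensity_apply _ .univ, Measure.restrict_univ,
    ← ofReal_integral_eq_lintegral_ofReal, ← intervalIntegral.integral_of_le zero_le_one,
    intervalIntegral.integral_const_mul, integral_pow]
  · have : (n : ℝ) + 1 ≠ 0 := by positivity
    field_simp
    simp
  · exact (Continuous.integrableOn_Icc (by fun_prop)).mono_set Set.Ioc_subset_Icc_self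
  · filter_upwards [ae_restrict_mem measurableSet_Ioc] with t ht
    have := ht.1.le
    positivity

lemma ae_powerLaw (n : ℕ) : ∀ᵐ t ∂powerLaw n, t ∈ Set.Ioc (0 : ℝ) 1 :=
  (withDensity_absolutelyContinuous _ _).ae_le (ae_restrict_mem measurableSet_Ioc)

lemma integrable_of_continuous_of_ae_mem {α F : Type*} [TopologicalSpace α] [MeasurableSpace α]
    [BorelSpace α] [T2Space α] [NormedAddCommGroup F] {μ : Measure α} [IsFiniteMeasure μ]
    {K : Set α} (hK : IsCompact K) (hμ : ∀ᵐ x ∂μ, x ∈ K) {f : α → F} (hf : Continuous f) :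
    Integrable f μ := by
  have := hf.continuousOn.integrableOn_compact (μ := μ) hK
  rwa [IntegrableOn, Measure.restrict_eq_self_of_ae_mem hμ] at this

lemma integrable_powerLaw (n : ℕ) {f : ℝ → ℝ} (hf : Continuous f) : Integrable f (powerLaw n) :=
  integrable_of_continuous_of_ae_mem isCompact_Icc
    ((ae_powerLaw n).mono fun _ h => Set.Ioc_subset_Icc_self h) hf

/-- Cauchy–Schwarz bounds Var f by the covariance of t with Q, a primitive of f'². Integration by
parts turns this covariance into an integral of f'² against the Stein kernel t(1-t)/(n+2) of the
law. -/
lemma variance_powerLaw_le (n : ℕ) {f : ℝ → ℝ} (hf : ContDiff ℝ 1 f) :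
    ∫ t, f t ^ 2 ∂powerLaw n - (∫ t, f t ∂powerLaw n) ^ 2 ≤
      ∫ t, t * (1 - t) * deriv f t ^ 2 / (n + 2) ∂powerLaw n := by
  set Q : ℝ → ℝ := fun x => ∫ z in (0 : ℝ)..x, deriv f z ^ 2
  have hc : Continuous fun z => deriv f z ^ 2 := (hf.continuous_deriv le_rfl).pow 2
  have hQ : ∀ x, HasDerivAt Q (deriv f x ^ 2) x := fun x =>
    intervalIntegral.integral_hasDerivAt_right (hc.intervalIntegrable _ _)
      hc.stronglyMeasurable.stronglyMeasurableAtFilter hc.continuousAt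
  have hQc : Continuous Q := continuous_iff_continuousAt.2 fun x => (hQ x).continuousAt
  have hfc := hf.continuous
  refine (variance_le_covariance (sq_sub_le_sub_mul_sub hf) (integrable_powerLaw n hfc)
    (integrable_powerLaw n (hfc.pow 2)) (integrable_powerLaw n continuous_id)
    (integrable_powerLaw n hQc) (integrable_powerLaw n (continuous_id.mul hQc))).trans_eq ?_
  have hn : (n : ℝ) + 2 ≠ 0 := by positivity
  have hm : ∫ t, t ∂powerLaw n = (n + 1) / (n + 2) := by
    rw [integral_powerLaw]
    have : ∀ t : ℝ, (n + 1) * t ^ n * t = (n + 1) * t ^ (n + 1) := fun t => by ring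
    simp_rw [this]
    rw [intervalIntegral.integral_const_mul, integral_pow]
    push_cast
    simp
    ring
  change _ - (∫ t, t ∂powerLaw n) * _ = _
  rw [hm, ← integral_const_mul]
  change ∫ t, t * Q t ∂powerLaw n - ∫ t, (n + 1) / (n + 2) * Q t ∂powerLaw n = _
  rw [← integral_sub (f := fun t => t * Q t) (integrable_powerLaw n (by fun_prop))
    ((integrable_powerLaw n hQc).const_mul _), integral_powerLaw, integral_powerLaw]
  -- W is a primitive of the density times (mean - t). It vanishes at 0 and 1, so there are no
  -- boundary terms, and it equals the density times t(1-t)/(n+2).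
  set W : ℝ → ℝ := fun t => (n + 1) / (n + 2) * (t ^ (n + 1) - t ^ (n + 2))
  have hW : ∀ t, HasDerivAt W ((n + 1) * t ^ n * ((n + 1) / (n + 2) - t)) t := by
    intro t
    have := ((hasDerivAt_pow (n + 1) t).sub (hasDerivAt_pow (n + 2) t)).const_mul
      (((n : ℝ) + 1) / (n + 2))
    refine HasDerivAt.congr_deriv (f := W) this ?_
    simp only [Nat.add_sub_cancel, show n + 2 - 1 = n + 1 from rfl]
    push_cast
    field_simp
    ring
  have hWQ : ∫ t in (0 : ℝ)..1, ((n + 1) * t ^ n * ((n + 1) / (n + 2) - t) * Q t +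
      W t * deriv f t ^ 2) = 0 := by
    rw [intervalIntegral.integral_eq_sub_of_hasDerivAt (f := fun t => W t * Q t)
      (fun t _ => (hW t).mul (hQ t))]
    · simp [W]
    · exact Continuous.intervalIntegrable (by fun_prop) _ _
  rw [intervalIntegral.integral_add (Continuous.intervalIntegrable (by fun_prop) _ _)
    (Continuous.intervalIntegrable (by fun_prop) _ _)] at hWQ
  have e1 : ∫ t in (0 : ℝ)..1, (n + 1) * t ^ n * (t * Q t - (n + 1) / (n + 2) * Q t) =
      - ∫ t in (0 : ℝ)..1, (n + 1) * t ^ n * ((n + 1) / (n + 2) - t) * Q t := by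
    rw [← intervalIntegral.integral_neg]
    congr 1; funext t; ring
  have e2 : ∫ t in (0 : ℝ)..1, (n + 1) * t ^ n * (t * (1 - t) * deriv f t ^ 2 / (n + 2)) =
      ∫ t in (0 : ℝ)..1, W t * deriv f t ^ 2 := by
    congr 1; funext t; simp only [W]; field_simp; ring
  rw [e2]
  refine Eq.trans e1 ?_
  linarith

/-! ### Conical coordinates and the uniform law of a simplex. -/

/-- The point of a simplex which divides the segment from the last vertex to the point of the
opposite facet with barycentric coordinates `w` in the ratio `t : 1 - t`. -/
def cone {n : ℕ} (t : ℝ) (w : Fin (n + 1) → ℝ) : Fin (n + 2) → ℝ :=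
  Fin.snoc (α := fun _ => ℝ) (t • w) (1 - t)

@[simp] lemma cone_castSucc {n : ℕ} (t : ℝ) (w : Fin (n + 1) → ℝ) (j : Fin (n + 1)) :
    cone t w j.castSucc = t * w j := by simp [cone]

@[simp] lemma cone_last {n : ℕ} (t : ℝ) (w : Fin (n + 1) → ℝ) :
    cone t w (Fin.last _) = 1 - t := by simp [cone]

lemma contDiff_cone {n : ℕ} {k : WithTop ℕ∞} :
    ContDiff ℝ k fun q : ℝ × (Fin (n + 1) → ℝ) => cone q.1 q.2 := by
  rw [contDiff_pi]
  intro j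
  induction j using Fin.lastCases with
  | last => simp only [cone_last]; fun_prop
  | cast j => simp only [cone_castSucc]; fun_prop

lemma continuous_cone {n : ℕ} :
    Continuous fun q : ℝ × (Fin (n + 1) → ℝ) => cone q.1 q.2 :=
  (contDiff_cone (k := 0)).continuous

/-- The uniform probability measure on the standard simplex, in barycentric coordinates. -/
def uniform : (n : ℕ) → Measure (Fin (n + 1) → ℝ)
  | 0 => Measure.dirac fun _ => 1
  -- The slice at parameter t is an n-dimensional simplex scaled by t, which explains the weight
  -- t^n.
  | n + 1 => ((powerLaw n).prod (uniform n)).map fun q => cone q.1 q.2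

instance isProbabilityMeasure_uniform : (n : ℕ) → IsProbabilityMeasure (uniform n)
  | 0 => by rw [uniform]; infer_instance
  | n + 1 => by
    have := isProbabilityMeasure_uniform n
    rw [uniform]
    exact Measure.isProbabilityMeasure_map continuous_cone.aemeasurable

lemma cone_mem_stdSimplex {n : ℕ} {t : ℝ} {w : Fin (n + 1) → ℝ} (ht : t ∈ Set.Icc (0 : ℝ) 1)
    (hw : w ∈ stdSimplex ℝ (Fin (n + 1))) : cone t w ∈ stdSimplex ℝ (Fin (n + 2)) := by
  refine ⟨fun j => ?_, ?_⟩
  · induction j using Fin.lastCases with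
    | last => simpa using ht.2
    | cast j => simpa using mul_nonneg ht.1 (hw.1 j)
  · rw [Fin.sum_univ_castSucc]
    simp [← Finset.mul_sum, hw.2]

lemma ae_uniform (n : ℕ) : ∀ᵐ w ∂uniform n, w ∈ stdSimplex ℝ (Fin (n + 1)) := by
  induction n with
  | zero =>
    rw [uniform, ae_dirac_iff (p := fun w => w ∈ stdSimplex ℝ (Fin (0 + 1)))
      (isClosed_stdSimplex ℝ (Fin _)).measurableSet]
    simp [stdSimplex]
  | succ n ih =>
    rw [uniform, ae_map_iff (p := fun w => w ∈ stdSimplex ℝ (Fin (n + 2)))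
      continuous_cone.aemeasurable (isClosed_stdSimplex ℝ (Fin _)).measurableSet]
    filter_upwards [Measure.quasiMeasurePreserving_fst.ae (ae_powerLaw n),
      Measure.quasiMeasurePreserving_snd.ae ih] with q h1 h2
    exact cone_mem_stdSimplex (Set.Ioc_subset_Icc_self h1) h2

lemma integrable_uniform (n : ℕ) {f : (Fin (n + 1) → ℝ) → ℝ} (hf : Continuous f) :
    Integrable f (uniform n) :=
  integrable_of_continuous_of_ae_mem (isCompact_stdSimplex ℝ _) (ae_uniform n) hf

lemma integrable_powerLaw_prod_uniform (n : ℕ) {f : ℝ × (Fin (n + 1) → ℝ) → ℝ}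
    (hf : Continuous f) : Integrable f ((powerLaw n).prod (uniform n)) := by
  refine integrable_of_continuous_of_ae_mem
    ((isCompact_Icc (a := (0 : ℝ)) (b := 1)).prod (isCompact_stdSimplex ℝ _)) ?_ hf
  filter_upwards [Measure.quasiMeasurePreserving_fst.ae (ae_powerLaw n),
      Measure.quasiMeasurePreserving_snd.ae (ae_uniform n)] with q h1 h2
  exact ⟨Set.Ioc_subset_Icc_self h1, h2⟩

lemma integral_uniform_succ (n : ℕ) {f : (Fin (n + 2) → ℝ) → ℝ} (hf : Continuous f) :
    ∫ w, f w ∂uniform (n + 1) = ∫ q, f (cone q.1 q.2) ∂(powerLaw n).prod (uniform n) := by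
  rw [uniform, integral_map continuous_cone.aemeasurable hf.aestronglyMeasurable]

/-! ### Edge derivatives and the inductive variance bound. -/

/-- The derivative of `F` along the edge from the vertex `k` to the vertex `j`. -/
def edgeDeriv {n : ℕ} (F : (Fin n → ℝ) → ℝ) (w : Fin n → ℝ) (j k : Fin n) : ℝ :=
  fderiv ℝ F w (Pi.single j 1 - Pi.single k 1)

/-- An energy density on the standard simplex. -/
def edgeEnergy {n : ℕ} (F : (Fin n → ℝ) → ℝ) (w : Fin n → ℝ) : ℝ :=
  ∑ k, ∑ j, if j < k then w j * w k * edgeDeriv F w j k ^ 2 / (k + 1) else 0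

lemma continuous_edgeDeriv {n : ℕ} {F : (Fin n → ℝ) → ℝ} (hF : ContDiff ℝ 1 F) (j k : Fin n) :
    Continuous fun w => edgeDeriv F w j k :=
  (hF.continuous_fderiv one_ne_zero).clm_apply continuous_const

lemma continuous_edgeEnergy {n : ℕ} {F : (Fin n → ℝ) → ℝ} (hF : ContDiff ℝ 1 F) :
    Continuous (edgeEnergy F) := by
  refine continuous_finsetSum _ fun k _ => continuous_finsetSum _ fun j _ => ?_
  split_ifs
  · have := continuous_edgeDeriv hF j k
    fun_prop
  · exact continuous_const

/-- The factor t, once squared, is absorbed by the coordinates: t² w_j w_k is the product of the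
coordinates j and k of `cone t w`. -/
lemma edgeDeriv_cone {n : ℕ} {F : (Fin (n + 2) → ℝ) → ℝ} (hF : ContDiff ℝ 1 F) (t : ℝ)
    (w : Fin (n + 1) → ℝ) (j k : Fin (n + 1)) :
    edgeDeriv (fun w => F (cone t w)) w j k =
      t * edgeDeriv F (cone t w) j.castSucc k.castSucc := by
  have h1 : HasFDerivAt (fun w : Fin (n + 1) → ℝ => cone t w)
      (ContinuousLinearMap.pi fun i : Fin (n + 2) =>
        Fin.lastCases (motive := fun _ => (Fin (n + 1) → ℝ) →L[ℝ] ℝ) 0 (fun i => t • ContinuousLinearMap.proj i) i) w := by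
    rw [hasFDerivAt_pi']
    intro i
    induction i using Fin.lastCases with
    | last =>
      simp only [cone_last]
      refine (hasFDerivAt_const (1 - t) w).congr_fderiv (ContinuousLinearMap.ext fun v => ?_)
      simp
    | cast i =>
      simp only [cone_castSucc]
      refine (((ContinuousLinearMap.proj (R := ℝ) (φ := fun _ : Fin (n + 1) => ℝ)
        i).hasFDerivAt (x := w)).const_smul t).congr_fderiv (ContinuousLinearMap.ext fun v => ?_)
      simp
  have h2 := ((hF.differentiable one_ne_zero) (cone t w)).hasFDerivAt.comp w h1
  have h3 : fderiv ℝ (fun w => F (cone t w)) w = _ := h2.fderiv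
  rw [edgeDeriv, h3, edgeDeriv, ContinuousLinearMap.comp_apply, ← smul_eq_mul, ← map_smul]
  congr 1
  funext i
  induction i using Fin.lastCases with
  | last => simp
  | cast i => simp [Pi.single_apply]

lemma deriv_cone {n : ℕ} {F : (Fin (n + 2) → ℝ) → ℝ} (hF : ContDiff ℝ 1 F) (t : ℝ)
    {w : Fin (n + 1) → ℝ} (hw : ∑ j, w j = 1) :
    deriv (fun t => F (cone t w)) t =
      ∑ j, w j * edgeDeriv F (cone t w) j.castSucc (Fin.last _) := by
  have h1 : HasDerivAt (fun t => cone t w)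
      (∑ j : Fin (n + 1), w j • (Pi.single j.castSucc 1 - Pi.single (Fin.last _) 1)) t := by
    rw [hasDerivAt_pi]
    intro i
    induction i using Fin.lastCases with
    | last => simpa [Finset.sum_apply, hw] using (hasDerivAt_id t).const_sub 1
    | cast i => simpa [Finset.sum_apply, Pi.single_apply] using (hasDerivAt_id t).mul_const (w i)
  have h2 := ((hF.differentiable one_ne_zero) (cone t w)).hasFDerivAt.comp_hasDerivAt t h1
  have h3 : deriv (fun t => F (cone t w)) t = _ := h2.deriv
  rw [h3, map_sum]
  simp [edgeDeriv]

/-- This splitting drives the induction: edges inside the slice form the energy of the slice, and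
the remaining edges end at the last vertex, whose index n + 1 gives the denominator n + 2. -/
lemma edgeEnergy_cone {n : ℕ} {F : (Fin (n + 2) → ℝ) → ℝ} (hF : ContDiff ℝ 1 F) (t : ℝ)
    (w : Fin (n + 1) → ℝ) :
    edgeEnergy F (cone t w) = edgeEnergy (fun w => F (cone t w)) w +
      ∑ j, t * w j * (1 - t) * edgeDeriv F (cone t w) j.castSucc (Fin.last _) ^ 2 / (n + 2) := by
  rw [edgeEnergy, Fin.sum_univ_castSucc, edgeEnergy]
  congr 1
  · refine Finset.sum_congr rfl fun k _ => ?_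
    rw [Fin.sum_univ_castSucc]
    simp only [Fin.castSucc_lt_castSucc_iff, cone_castSucc, edgeDeriv_cone hF, Fin.val_castSucc]
    rw [if_neg (by simp [Fin.le_last]), add_zero]
    refine Finset.sum_congr rfl fun j _ => ?_
    split_ifs <;> ring
  · rw [Fin.sum_univ_castSucc]
    simp [Fin.castSucc_lt_last]
    refine Finset.sum_congr rfl fun j _ => ?_
    ring

/-- A Poincaré inequality on the standard simplex. -/
theorem variance_uniform_le (n : ℕ) {F : (Fin (n + 1) → ℝ) → ℝ} (hF : ContDiff ℝ 1 F) :
    ∫ w, F w ^ 2 ∂uniform n - (∫ w, F w ∂uniform n) ^ 2 ≤ ∫ w, edgeEnergy F w ∂uniform n := by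
  induction n with
  | zero => simp [uniform, edgeEnergy]
  | succ n ih =>
    have hFc := hF.continuous
    have hH : Continuous fun q : ℝ × (Fin (n + 1) → ℝ) => F (cone q.1 q.2) :=
      hFc.comp continuous_cone
    obtain ⟨C, hC⟩ := (isCompact_Icc (a := (0 : ℝ)) (b := 1)).prod
      (isCompact_stdSimplex ℝ (Fin (n + 1))) |>.exists_bound_of_continuousOn hH.continuousOn
    have hae : ∀ᵐ q ∂(powerLaw n).prod (uniform n),
        q ∈ Set.Icc (0 : ℝ) 1 ×ˢ stdSimplex ℝ (Fin (n + 1)) := by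
      filter_upwards [Measure.quasiMeasurePreserving_fst.ae (ae_powerLaw n),
        Measure.quasiMeasurePreserving_snd.ae (ae_uniform n)] with q h1 h2
      exact ⟨Set.Ioc_subset_Icc_self h1, h2⟩
    rw [integral_uniform_succ n hFc, integral_uniform_succ n (f := fun w => F w ^ 2) (hFc.pow 2),
      integral_uniform_succ n (continuous_edgeEnergy hF)]
    -- Efron–Stein leaves a variance in w, bounded on each slice by induction, and a variance in t,
    -- bounded along each ray by `variance_powerLaw_le`.
    refine (variance_prod_le (μ := powerLaw n) (ν := uniform n)
      (H := fun q => F (cone q.1 q.2)) hH.aestronglyMeasurable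
      (hae.mono fun q hq => hC q hq)).trans ?_
    have hcont : ∀ j : Fin (n + 1), Continuous fun q : ℝ × (Fin (n + 1) → ℝ) =>
        edgeDeriv F (cone q.1 q.2) j.castSucc (Fin.last _) := fun j =>
      (continuous_edgeDeriv hF _ _).comp continuous_cone
    have c2 : Continuous fun q : ℝ × (Fin (n + 1) → ℝ) =>
        ∑ j, q.1 * q.2 j * (1 - q.1) *
          edgeDeriv F (cone q.1 q.2) j.castSucc (Fin.last _) ^ 2 / (n + 2) := by
      refine continuous_finsetSum _ fun j _ => ?_
      have := hcont j
      fun_prop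
    have c1 : Continuous fun q : ℝ × (Fin (n + 1) → ℝ) =>
        edgeEnergy (fun w => F (cone q.1 w)) q.2 := by
      have : ∀ q : ℝ × (Fin (n + 1) → ℝ), edgeEnergy (fun w => F (cone q.1 w)) q.2 =
          edgeEnergy F (cone q.1 q.2) - ∑ j, q.1 * q.2 j * (1 - q.1) *
          edgeDeriv F (cone q.1 q.2) j.castSucc (Fin.last _) ^ 2 / (n + 2) := fun q => by
        rw [edgeEnergy_cone hF]; ring
      simp_rw [this]
      exact ((continuous_edgeEnergy hF).comp continuous_cone).sub c2
    have i1 := integrable_powerLaw_prod_uniform n c1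
    have i2 := integrable_powerLaw_prod_uniform n c2
    simp_rw [edgeEnergy_cone hF]
    rw [integral_add i1 i2, integral_prod _ i1, integral_prod_symm _ i2]
    have iH2 := integrable_powerLaw_prod_uniform n (hH.pow 2)
    have bsq : ∀ {α : Type} [MeasurableSpace α] {μ : Measure α} [IsFiniteMeasure μ] {g : α → ℝ},
        AEStronglyMeasurable g μ → (∀ᵐ x ∂μ, |g x| ≤ C) → Integrable (fun x => g x ^ 2) μ := by
      intro α _ μ _ g hg hb
      refine .of_bound (hg.pow 2) (C ^ 2) ?_
      filter_upwards [hb] with x hx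
      rw [norm_pow]; exact pow_le_pow_left₀ (abs_nonneg _) hx 2
    refine add_le_add ?_ ?_
    · refine integral_mono_ae (iH2.integral_prod_left.sub (bsq
        hH.aestronglyMeasurable.integral_prod_right' ?_)) i1.integral_prod_left (.of_forall
          fun t => ?_)
      · filter_upwards [ae_powerLaw n] with t ht
        have : ∀ᵐ w ∂uniform n, ‖F (cone t w)‖ ≤ C := by
          filter_upwards [ae_uniform n] with w hw
          exact hC (t, w) ⟨Set.Ioc_subset_Icc_self ht, hw⟩
        simpa using norm_integral_le_of_norm_le_const this
      · exact ih (hF.comp (contDiff_cone.comp (contDiff_const.prodMk contDiff_id)))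
    · refine integral_mono_ae (iH2.integral_prod_right.sub (bsq
        hH.aestronglyMeasurable.prod_swap.integral_prod_right' ?_)) i2.integral_prod_right ?_
      · filter_upwards [ae_uniform n] with w hw
        have : ∀ᵐ t ∂powerLaw n, ‖F (cone t w)‖ ≤ C := by
          filter_upwards [ae_powerLaw n] with t ht
          exact hC (t, w) ⟨Set.Ioc_subset_Icc_self ht, hw⟩
        simpa using norm_integral_le_of_norm_le_const this
      · filter_upwards [ae_uniform n] with w hw
        have hd : ContDiff ℝ 1 fun t => F (cone t w) :=
          hF.comp (contDiff_cone.comp (contDiff_id.prodMk contDiff_const))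
        refine (variance_powerLaw_le n hd).trans ?_
        have hdc := hd.continuous_deriv le_rfl
        refine integral_mono_ae (integrable_powerLaw n (by fun_prop))
          (integrable_powerLaw n (c2.comp (Continuous.prodMk_left w))) ?_
        filter_upwards [ae_powerLaw n] with t ht
        rw [deriv_cone hF t hw.2, ← Finset.sum_div]
        refine div_le_div_of_nonneg_right ?_ (by positivity)
        -- The derivative along a ray is a convex combination of edge derivatives, so Jensen's
        -- inequality applies to its square.
        have hj : (∑ j, w j * edgeDeriv F (cone t w) j.castSucc (Fin.last _)) ^ 2 ≤
            ∑ j, w j * edgeDeriv F (cone t w) j.castSucc (Fin.last _) ^ 2 :=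
          Real.pow_arith_mean_le_arith_mean_pow_of_even _ _ _ (fun j _ => hw.1 j) hw.2 even_two
        have ht1 : 0 ≤ t * (1 - t) := mul_nonneg ht.1.le (by linarith [ht.2])
        refine (mul_le_mul_of_nonneg_left hj ht1).trans_eq ?_
        rw [Finset.mul_sum]
        exact Finset.sum_congr rfl fun j _ => by ring

/-! ### The uniform measure of an embedded simplex -/

/-- The simplex spanned by the origin and the unit vectors. -/
def corner (n : ℕ) : Set (Fin n → ℝ) := {x | (∀ i, 0 ≤ x i) ∧ ∑ i, x i ≤ 1}

lemma measurableSet_corner (n : ℕ) : MeasurableSet (corner n) := by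
  have h : IsClosed (corner n) := by
    rw [corner, Set.ofPred_and, Set.ofPred_forall]
    exact (isClosed_iInter fun i => isClosed_le continuous_const (continuous_apply i)).inter
      (isClosed_le (continuous_finsetSum _ fun i _ => continuous_apply i) continuous_const)
  exact h.measurableSet

/-- The map `cone` in the coordinates which omit the first barycentric one. -/
def coneTail {n : ℕ} (q : ℝ × (Fin n → ℝ)) : Fin (n + 1) → ℝ :=
  Fin.snoc (α := fun _ => ℝ) (q.1 • q.2) (1 - q.1)

lemma continuous_coneTail {n : ℕ} : Continuous (coneTail (n := n)) := by
  rw [continuous_pi_iff]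
  intro j
  induction j using Fin.lastCases with
  | last => simp only [coneTail, Fin.snoc_last]; fun_prop
  | cast j => simp only [coneTail, Fin.snoc_castSucc]; fun_prop

lemma tail_cone {n : ℕ} (t : ℝ) (w : Fin (n + 1) → ℝ) :
    Fin.tail (cone t w) = coneTail (t, Fin.tail w) := by
  funext j
  induction j using Fin.lastCases with
  | last => simp [coneTail, Fin.tail]
  | cast j =>
    change cone t w j.castSucc.succ = _
    rw [Fin.succ_castSucc, cone_castSucc]
    simp [coneTail, Fin.tail]

lemma continuous_tail {n : ℕ} : Continuous fun w : Fin (n + 1) → ℝ => (Fin.tail w : Fin n → ℝ) :=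
  continuous_pi fun j => continuous_apply j.succ

lemma volume_eq_lintegral_snoc {n : ℕ} {T : Set (Fin (n + 1) → ℝ)} (hT : MeasurableSet T) :
    volume T = ∫⁻ s, volume {y : Fin n → ℝ | (Fin.snoc (α := fun _ => ℝ) y s) ∈ T} := by
  have h := (volume_preserving_piFinSuccAbove (fun _ : Fin (n + 1) => ℝ) (Fin.last n)).symm
  rw [← h.measure_preimage hT.nullMeasurableSet, Measure.volume_eq_prod,
    Measure.prod_apply (h.measurable hT)]
  congr with s
  congr 1
  ext y
  simp only [Set.mem_preimage, Set.mem_ofPred_eq]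
  have : (MeasurableEquiv.piFinSuccAbove (fun _ : Fin (n + 1) => ℝ) (Fin.last n)).symm (s, y) =
    Fin.snoc (α := fun _ => ℝ) y s := Fin.insertNth_last' s y
  rw [this]

lemma snoc_mem_corner_iff {n : ℕ} {y : Fin n → ℝ} {t : ℝ} (ht : t ≤ 1) :
    (Fin.snoc (α := fun _ => ℝ) y (1 - t) : Fin (n + 1) → ℝ) ∈ corner (n + 1) ↔
      (∀ i, 0 ≤ y i) ∧ ∑ i, y i ≤ t := by
  simp only [corner, Set.mem_ofPred_eq, Fin.forall_fin_succ', Fin.snoc_castSucc, Fin.snoc_last,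
    Fin.sum_univ_castSucc]
  constructor
  · rintro ⟨⟨h1, -⟩, h2⟩
    exact ⟨h1, by linarith⟩
  · rintro ⟨h1, h2⟩
    exact ⟨⟨h1, by linarith⟩, by linarith⟩

-- Fubini in the last coordinate 1 - t: the slice of the larger corner simplex is t times the
-- smaller one, of volume factor t^n, against the density (n + 1) t^n.
open scoped Pointwise in
lemma map_coneTail (n : ℕ) :
    ((powerLaw n).prod (volume.restrict (corner n))).map coneTail =
      ((n : ENNReal) + 1) • volume.restrict (corner (n + 1)) := by
  ext S hS
  have hm := continuous_coneTail (n := n) |>.measurable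
  rw [Measure.map_apply hm hS, Measure.prod_apply (hm hS), Measure.smul_apply,
    Measure.restrict_apply hS, volume_eq_lintegral_snoc (hS.inter (measurableSet_corner _)),
    ← lintegral_sub_left_eq_self (μ := volume) _ (1 : ℝ), powerLaw,
    lintegral_withDensity_eq_lintegral_mul₀ (by fun_prop)
      (measurable_measure_prodMk_left (hm hS)).aemeasurable, smul_eq_mul,
    ← lintegral_const_mul' _ _ (by simp), ← lintegral_indicator measurableSet_Ioc]
  refine lintegral_congr_ae ?_
  -- The slice at t = 0 is a single point and not covered by the scaling argument; it is discarded
  -- as a null set of parameters.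
  have h0 : ∀ᵐ t : ℝ, t ≠ 0 := by simp [ae_iff]
  filter_upwards [h0] with t ht0
  by_cases ht : t ∈ Set.Ioc (0 : ℝ) 1
  · rw [Set.indicator_of_mem ht, Pi.mul_apply]
    have e1 : {y : Fin n → ℝ | (Fin.snoc (α := fun _ => ℝ) y (1 - t) : Fin (n + 1) → ℝ) ∈
        S ∩ corner (n + 1)} = t • ((Prod.mk t ⁻¹' (coneTail ⁻¹' S)) ∩ corner n) := by
      ext y
      rw [Set.mem_smul_set_iff_inv_smul_mem₀ ht.1.ne']
      rw [Set.mem_ofPred_eq, Set.mem_inter_iff, snoc_mem_corner_iff ht.2]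
      simp only [Set.mem_ofPred_eq, Set.mem_inter_iff, Set.mem_preimage,
        coneTail, smul_inv_smul₀ ht.1.ne', corner, Pi.smul_apply, smul_eq_mul, ← Finset.mul_sum]
      refine and_congr Iff.rfl (and_congr (forall_congr' fun i => ?_) ?_)
      · rw [mul_nonneg_iff_of_pos_left (inv_pos.2 ht.1)]
      · rw [inv_mul_le_iff₀ ht.1, mul_one]
    rw [e1, Measure.addHaar_smul_of_nonneg _ ht.1.le, Measure.restrict_apply
      (measurable_prodMk_left (hm hS)), Module.finrank_fin_fun, ← mul_assoc,
      ENNReal.ofReal_mul (by positivity)]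
    congr 2
    rw [ENNReal.ofReal_add (by positivity) zero_le_one]
    simp
  · rw [Set.indicator_of_notMem ht]
    symm
    have e1 : {y : Fin n → ℝ | (Fin.snoc (α := fun _ => ℝ) y (1 - t) : Fin (n + 1) → ℝ) ∈
        S ∩ corner (n + 1)} = ∅ := by
      rw [Set.eq_empty_iff_forall_notMem]
      rintro y ⟨-, h1, h2⟩
      have h3 := h1 (Fin.last n)
      rw [Fin.snoc_last] at h3
      have h4 : t ≤ 1 := by linarith
      have h5 := (snoc_mem_corner_iff h4).1 ⟨h1, h2⟩
      have h6 : 0 ≤ t := (Finset.sum_nonneg fun i _ => h5.1 i).trans h5.2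
      exact ht ⟨lt_of_le_of_ne h6 (Ne.symm ht0), h4⟩
    rw [e1]
    simp

/-- The constant built here is n!, but only its being nonzero and finite is recorded: total masses
determine the constants later. -/
lemma exists_map_tail_uniform (n : ℕ) : ∃ c : ENNReal, c ≠ 0 ∧ c ≠ ⊤ ∧
    (uniform n).map (fun w => (Fin.tail w : Fin n → ℝ)) = c • volume.restrict (corner n) := by
  induction n with
  | zero =>
    refine ⟨1, one_ne_zero, ENNReal.one_ne_top, ?_⟩
    have : corner 0 = Set.univ := by
      ext x; simp [corner]
    rw [this, uniform, Measure.map_dirac' continuous_tail.measurable, one_smul,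
      Measure.restrict_univ, Measure.volume_pi_eq_dirac]
    congr 1
    exact Subsingleton.elim _ _
  | succ n ih =>
    obtain ⟨c, hc0, hc, h⟩ := ih
    refine ⟨c * (n + 1), mul_ne_zero hc0 (by simp), ENNReal.mul_ne_top hc (by simp), ?_⟩
    rw [uniform, Measure.map_map continuous_tail.measurable continuous_cone.measurable]
    have e1 : (fun w => (Fin.tail w : Fin (n + 1) → ℝ)) ∘
        (fun q : ℝ × (Fin (n + 1) → ℝ) => cone q.1 q.2) =
        coneTail ∘ Prod.map id (fun w => (Fin.tail w : Fin n → ℝ)) := by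
      funext q
      exact tail_cone _ _
    rw [e1, ← Measure.map_map continuous_coneTail.measurable
      (measurable_id.prodMap continuous_tail.measurable),
      ← Measure.map_prod_map _ _ measurable_id continuous_tail.measurable, Measure.map_id, h,
      Measure.prod_smul_right, Measure.map_smul, map_coneTail, smul_smul]

/-- The point with given barycentric coordinates. -/
def bary {n d : ℕ} (p : Fin (n + 1) → E d) (w : Fin (n + 1) → ℝ) : E d := ∑ i, w i • p i

lemma continuous_bary {n d : ℕ} (p : Fin (n + 1) → E d) : Continuous (bary p) := by
  unfold bary; fun_prop

lemma contDiff_bary {n d : ℕ} (p : Fin (n + 1) → E d) {k : WithTop ℕ∞} :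
    ContDiff ℝ k (bary p) := by
  unfold bary; fun_prop

lemma convexHull_range_eq_image {n d : ℕ} (p : Fin (n + 1) → E d) :
    convexHull ℝ (Set.range p) = bary p '' stdSimplex ℝ (Fin (n + 1)) := by
  rw [← convexHull_basis_eq_stdSimplex]
  have : bary p = (Fintype.linearCombination ℝ p : (Fin (n + 1) → ℝ) →ₗ[ℝ] E d) := by
    funext w; simp [bary, Fintype.linearCombination_apply]
  rw [this, LinearMap.image_convexHull, ← Set.range_comp]
  congr 2
  funext i
  simp [Fintype.linearCombination_apply]

/-- The linear part of the parametrisation of a simplex. -/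
def edgeMap {n d : ℕ} (p : Fin (n + 1) → E d) : E n →ₗ[ℝ] E d :=
  ∑ i : Fin n, (LinearMap.toSpanSingleton ℝ (E d) (p i.succ - p 0)) ∘ₗ
    (EuclideanSpace.proj i : E n →L[ℝ] ℝ).toLinearMap

lemma edgeMap_apply {n d : ℕ} (p : Fin (n + 1) → E d) (x : E n) :
    edgeMap p x = ∑ i : Fin n, x i • (p i.succ - p 0) := by
  simp [edgeMap]

lemma injective_edgeMap {n d : ℕ} {p : Fin (n + 1) → E d} (hp : AffineIndependent ℝ p) :
    Function.Injective (edgeMap p) := by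
  rw [injective_iff_map_eq_zero]
  intro x hx
  rw [edgeMap_apply] at hx
  have h := (affineIndependent_iff.1 hp) Finset.univ
    (Fin.cons (α := fun _ => ℝ) (-∑ i, x i) fun i => x i)
    (by simp [Fin.sum_univ_succ]) (by
      rw [Fin.sum_univ_succ]
      simp only [smul_sub, Finset.sum_sub_distrib, ← Finset.sum_smul] at hx
      simp only [Fin.cons_zero, Fin.cons_succ, neg_smul]
      rw [← hx]; abel)
  ext i
  simpa using h i.succ (Finset.mem_univ _)

lemma bary_eq {n d : ℕ} (p : Fin (n + 1) → E d) {w : Fin (n + 1) → ℝ} (hw : ∑ i, w i = 1) :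
    bary p w = p 0 + edgeMap p (WithLp.toLp 2 (Fin.tail w : Fin n → ℝ)) := by
  rw [edgeMap_apply, bary, Fin.sum_univ_succ]
  have : w 0 = 1 - ∑ i : Fin n, w i.succ := by
    rw [Fin.sum_univ_succ] at hw; linarith
  rw [this]
  simp only [Fin.tail, smul_sub, Finset.sum_sub_distrib, ← Finset.sum_smul, sub_smul, one_smul]
  abel

lemma cons_mem_stdSimplex {n : ℕ} {x : Fin n → ℝ} (hx : x ∈ corner n) :
    (Fin.cons (α := fun _ => ℝ) (1 - ∑ i, x i) x : Fin (n + 1) → ℝ) ∈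
      stdSimplex ℝ (Fin (n + 1)) := by
  refine ⟨fun i => ?_, by simp [Fin.sum_univ_succ]⟩
  induction i using Fin.cases with
  | zero => simpa using hx.2
  | succ i => simpa using hx.1 i

lemma tail_mem_corner {n : ℕ} {w : Fin (n + 1) → ℝ} (hw : w ∈ stdSimplex ℝ (Fin (n + 1))) :
    (Fin.tail w : Fin n → ℝ) ∈ corner n := by
  refine ⟨fun i => hw.1 _, ?_⟩
  have h := hw.2
  rw [Fin.sum_univ_succ] at h
  have := hw.1 0
  simp only [Fin.tail]
  linarith

lemma convexHull_range_eq_image_corner {n d : ℕ} (p : Fin (n + 1) → E d) :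
    convexHull ℝ (Set.range p) =
      (fun x : Fin n → ℝ => p 0 + edgeMap p (WithLp.toLp 2 x)) '' corner n := by
  rw [convexHull_range_eq_image]
  ext z
  constructor
  · rintro ⟨w, hw, rfl⟩
    exact ⟨_, tail_mem_corner hw, (bary_eq p hw.2).symm⟩
  · rintro ⟨x, hx, rfl⟩
    exact ⟨_, cons_mem_stdSimplex hx, by rw [bary_eq p (cons_mem_stdSimplex hx).2, Fin.tail_cons]⟩

/-- The factor is the normalised determinant of the edge map, positive because the edge vectors are
independent. -/
lemma exists_hausdorffMeasure_image {n d : ℕ} {p : Fin (n + 1) → E d}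
    (hp : AffineIndependent ℝ p) : ∃ c : ENNReal, c ≠ 0 ∧ c ≠ ⊤ ∧ ∀ s : Set (Fin n → ℝ),
    (Measure.euclideanHausdorffMeasure n : Measure (E d))
      ((fun x => p 0 + edgeMap p (WithLp.toLp 2 x)) '' s) = c * volume s := by
  refine ⟨ENNReal.ofReal (edgeMap p).normDet, ?_, ENNReal.ofReal_ne_top, fun s => ?_⟩
  · rw [Ne, ENNReal.ofReal_eq_zero, not_le]
    refine lt_of_le_of_ne (LinearMap.normDet_nonneg _) fun h => ?_
    exact LinearMap.normDet_eq_zero_iff_ker_ne_bot.1 h.symm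
      (LinearMap.ker_eq_bot.2 (injective_edgeMap hp))
  · have e1 : (fun x => p 0 + edgeMap p (WithLp.toLp 2 x)) '' s =
        (IsometryEquiv.addLeft (p 0)) '' (edgeMap p '' (WithLp.toLp 2 '' s)) := by
      rw [Set.image_image, Set.image_image]; rfl
    have h2 := LinearMap.euclideanHausdorffMeasure_image_eq_normDet_mul_volume (edgeMap p)
      (WithLp.toLp 2 '' s)
    rw [finrank_euclideanSpace_fin] at h2
    rw [e1, (IsometryEquiv.isometry _).euclideanHausdorffMeasure_image, h2]
    congr 1
    rw [← (PiLp.volume_preserving_toLp (Fin n)).measure_preimage_emb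
      (MeasurableEquiv.toLp 2 (Fin n → ℝ)).measurableEmbedding,
      Set.preimage_image_eq _ (WithLp.toLp_injective 2)]

/-- The uniform measure in barycentric coordinates is, up to a constant, the surface measure. -/
theorem exists_restrict_eq_smul_map {n d : ℕ} {p : Fin (n + 1) → E d}
    (hp : AffineIndependent ℝ p) : ∃ c : ENNReal, c ≠ 0 ∧ c ≠ ⊤ ∧
    (Measure.euclideanHausdorffMeasure n : Measure (E d)).restrict (convexHull ℝ (Set.range p)) =
      c • (uniform n).map (bary p) := by
  obtain ⟨c, hc0, hc, h⟩ := exists_map_tail_uniform n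
  obtain ⟨c', hc0', hc', h'⟩ := exists_hausdorffMeasure_image hp
  refine ⟨c' * c⁻¹, mul_ne_zero hc0' (ENNReal.inv_ne_zero.2 hc),
    ENNReal.mul_ne_top hc' (ENNReal.inv_ne_top.2 hc0), ?_⟩
  set g : (Fin n → ℝ) → E d := fun x => p 0 + edgeMap p (WithLp.toLp 2 x) with hg
  have hgc : Continuous g := by
    have := (edgeMap p).continuous_of_finiteDimensional
    fun_prop
  have hginj : Function.Injective g := fun x y hxy => by
    have := injective_edgeMap hp (add_left_cancel hxy)
    exact WithLp.toLp_injective 2 this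
  have e1 : (uniform n).map (bary p) = ((uniform n).map fun w => (Fin.tail w : Fin n → ℝ)).map g := by
    rw [Measure.map_map hgc.measurable continuous_tail.measurable]
    refine Measure.map_congr ?_
    filter_upwards [ae_uniform n] with w hw
    exact bary_eq p hw.2
  rw [e1, h]
  ext S hS
  have e2 : S ∩ convexHull ℝ (Set.range p) = g '' (g ⁻¹' S ∩ corner n) := by
    rw [convexHull_range_eq_image_corner, Set.image_preimage_inter]
  rw [Measure.restrict_apply hS, e2, h', Measure.smul_apply, Measure.map_apply hgc.measurable hS,
    Measure.smul_apply, Measure.restrict_apply (hgc.measurable hS), smul_eq_mul, smul_eq_mul,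
    mul_assoc, ← mul_assoc c⁻¹, ENNReal.inv_mul_cancel hc0 hc, one_mul]

/-! ### Symmetry of the uniform measure, and the Poincaré inequality of a simplex -/

/-- The recursive definition hides the symmetry. On the simplex spanned by an orthonormal basis, the
law is the normalised Hausdorff measure of the convex hull, which does not see the order of the
vertices. -/
lemma map_perm_uniform (n : ℕ) (π : Equiv.Perm (Fin (n + 1))) :
    (uniform n).map (fun w => w ∘ π) = uniform n := by
  set p : Fin (n + 1) → E (n + 1) := fun i => EuclideanSpace.single i 1
  have hp : AffineIndependent ℝ p :=
    EuclideanSpace.orthonormal_single.linearIndependent.affineIndependent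
  have hb : ∀ w : Fin (n + 1) → ℝ, bary p w = WithLp.toLp 2 w := by
    intro w
    ext i
    simp [bary, p, Pi.single_apply]
  have hp' : AffineIndependent ℝ (p ∘ π.symm) := hp.comp_embedding π.symm.toEmbedding
  obtain ⟨c, hc0, hc, h⟩ := exists_restrict_eq_smul_map hp
  obtain ⟨c', hc0', hc', h'⟩ := exists_restrict_eq_smul_map hp'
  rw [Set.range_comp, Set.range_eq_univ.2 π.symm.surjective, Set.image_univ, h] at h'
  have i1 := Measure.isProbabilityMeasure_map (μ := uniform n) (continuous_bary p).aemeasurable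
  have i2 := Measure.isProbabilityMeasure_map (μ := uniform n)
    (continuous_bary (p ∘ π.symm)).aemeasurable
  have hcc : c = c' := by
    have := congrArg (fun μ => μ Set.univ) h'
    simpa [measure_univ] using this
  rw [← hcc] at h'
  have h2 : (uniform n).map (bary p) = (uniform n).map (bary (p ∘ π.symm)) := by
    have := congrArg (fun μ => c⁻¹ • μ) h'
    simpa [smul_smul, ENNReal.inv_mul_cancel hc0 hc] using this
  have h3 := congrArg (fun μ => μ.map (WithLp.ofLp : E (n + 1) → Fin (n + 1) → ℝ)) h2
  have hm : Measurable (WithLp.ofLp : E (n + 1) → Fin (n + 1) → ℝ) :=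
    (PiLp.continuous_ofLp 2 _).measurable
  simp only at h3
  rw [Measure.map_map hm (continuous_bary _).measurable,
    Measure.map_map hm (continuous_bary _).measurable] at h3
  have e1 : WithLp.ofLp ∘ bary p = id := by
    funext w; simp [hb]
  have e2 : WithLp.ofLp ∘ bary (p ∘ π.symm) = fun w => w ∘ π := by
    funext w
    have : bary (p ∘ π.symm) w = bary p (w ∘ π) := by
      rw [bary, bary, ← Equiv.sum_comp π]
      simp
    simp [this, hb]
  rw [e1, e2, Measure.map_id] at h3
  exact h3.symm

lemma integral_perm_uniform {n : ℕ} (π : Equiv.Perm (Fin (n + 1))) {f : (Fin (n + 1) → ℝ) → ℝ}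
    (hf : Continuous f) : ∫ w, f (w ∘ π) ∂uniform n = ∫ w, f w ∂uniform n := by
  have hc : Continuous fun w : Fin (n + 1) → ℝ => w ∘ π := by fun_prop
  conv_rhs => rw [← map_perm_uniform n π]
  rw [integral_map hc.aemeasurable hf.aestronglyMeasurable]

/-! ### The Poincaré inequality with constant `h / π`. -/

/-- The contribution of one edge to the energy density. -/
def edgeTerm {n : ℕ} (F : (Fin n → ℝ) → ℝ) (w : Fin n → ℝ) (j k : Fin n) : ℝ :=
  w j * w k * edgeDeriv F w j k ^ 2

lemma continuous_edgeTerm {n : ℕ} {F : (Fin n → ℝ) → ℝ} (hF : ContDiff ℝ 1 F) (j k : Fin n) :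
    Continuous fun w => edgeTerm F w j k := by
  have := continuous_edgeDeriv hF j k
  unfold edgeTerm; fun_prop

lemma edgeTerm_comm {n : ℕ} (F : (Fin n → ℝ) → ℝ) (w : Fin n → ℝ) (j k : Fin n) :
    edgeTerm F w j k = edgeTerm F w k j := by
  have : edgeDeriv F w j k = - edgeDeriv F w k j := by
    rw [edgeDeriv, edgeDeriv, ← map_neg, neg_sub]
  rw [edgeTerm, edgeTerm, this]; ring

lemma edgeTerm_self {n : ℕ} (F : (Fin n → ℝ) → ℝ) (w : Fin n → ℝ) (j : Fin n) :
    edgeTerm F w j j = 0 := by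
  simp [edgeTerm, edgeDeriv]

lemma edgeTerm_nonneg {n : ℕ} (F : (Fin n → ℝ) → ℝ) {w : Fin n → ℝ} (hw : ∀ i, 0 ≤ w i)
    (j k : Fin n) : 0 ≤ edgeTerm F w j k :=
  mul_nonneg (mul_nonneg (hw j) (hw k)) (sq_nonneg _)

lemma sum_sum_eq_two_mul {n : ℕ} {f : Fin n → Fin n → ℝ} (hf : ∀ j k, f j k = f k j)
    (h0 : ∀ j, f j j = 0) :
    ∑ k, ∑ j, f j k = 2 * ∑ k, ∑ j, if j < k then f j k else 0 := by
  have h1 : ∑ k, ∑ j, f j k =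
      (∑ k, ∑ j, if j < k then f j k else 0) + ∑ k, ∑ j, if k < j then f j k else 0 := by
    simp_rw [← Finset.sum_add_distrib]
    refine Finset.sum_congr rfl fun k _ => Finset.sum_congr rfl fun j _ => ?_
    rcases lt_trichotomy j k with h | h | h
    · simp [h, h.not_gt]
    · simp [h, h0]
    · simp [h, h.not_gt]
  have h2 : (∑ k, ∑ j, if k < j then f j k else 0) = ∑ k, ∑ j, if j < k then f j k else 0 := by
    rw [Finset.sum_comm]
    simp_rw [fun j k => hf j k]
  rw [h1, h2]; ring

lemma sum_sum_ite_eq {n : ℕ} (f : Fin n → Fin n → ℝ) (a b : Fin n) :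
    (∑ k, ∑ j, if j = a ∧ k = b then f j k else 0) = f a b := by
  rw [Finset.sum_eq_single b, Finset.sum_eq_single a] <;> simp +contextual

/-- Every edge j < k other than (0, 1) has k ≥ 2, hence weight at most 1/3, which is 1/6 in a sum
over ordered pairs. The edge (0, 1) has weight 1/2 and leaves the excess 1/6. -/
lemma edgeEnergy_le {n : ℕ} (F : (Fin (n + 2) → ℝ) → ℝ) {w : Fin (n + 2) → ℝ}
    (hw : ∀ i, 0 ≤ w i) :
    edgeEnergy F w ≤ (1 / 6) * (∑ k, ∑ j, edgeTerm F w j k) + (1 / 6) * edgeTerm F w 0 1 := by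
  rw [sum_sum_eq_two_mul (edgeTerm_comm F w) (edgeTerm_self F w),
    ← sum_sum_ite_eq (edgeTerm F w) 0 1, ← mul_assoc, Finset.mul_sum, Finset.mul_sum,
    ← Finset.sum_add_distrib]
  refine Finset.sum_le_sum fun k _ => ?_
  rw [Finset.mul_sum, Finset.mul_sum, ← Finset.sum_add_distrib]
  refine Finset.sum_le_sum fun j _ => ?_
  have h0 := edgeTerm_nonneg F hw j k
  split_ifs with h1 h2 h2
  · obtain ⟨rfl, rfl⟩ := h2
    change edgeTerm F w 0 1 / _ ≤ _
    simp
    linarith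
  · have hk : 2 ≤ (k : ℕ) := by
      by_contra hk
      have h3 : (j : ℕ) < k := h1
      exact h2 ⟨Fin.ext (by rw [Fin.val_zero]; omega), Fin.ext (by rw [Fin.val_one]; omega)⟩
    have hk' : (2 : ℝ) ≤ (k : ℕ) := by exact_mod_cast hk
    change edgeTerm F w j k / _ ≤ _
    rw [div_le_iff₀ (by positivity)]
    nlinarith
  · linarith
  · linarith

lemma edgeDeriv_comp_perm {n : ℕ} {F : (Fin n → ℝ) → ℝ} (hF : ContDiff ℝ 1 F)
    (π : Equiv.Perm (Fin n)) (w : Fin n → ℝ) (j k : Fin n) :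
    edgeDeriv (fun w => F (w ∘ π)) w j k = edgeDeriv F (w ∘ π) (π.symm j) (π.symm k) := by
  have h1 := (LinearMap.toContinuousLinearMap
    (LinearMap.funLeft ℝ ℝ π : (Fin n → ℝ) →ₗ[ℝ] (Fin n → ℝ))).hasFDerivAt (x := w)
  have h2 := ((hF.differentiable one_ne_zero) (w ∘ π)).hasFDerivAt.comp w h1
  have h3 : fderiv ℝ (fun w => F (w ∘ π)) w = _ := h2.fderiv
  rw [edgeDeriv, h3, edgeDeriv, ContinuousLinearMap.comp_apply]
  congr 1
  funext i
  simp [LinearMap.funLeft, Pi.single_apply, Equiv.eq_symm_apply]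

lemma edgeTerm_comp_perm {n : ℕ} {F : (Fin n → ℝ) → ℝ} (hF : ContDiff ℝ 1 F)
    (π : Equiv.Perm (Fin n)) (w : Fin n → ℝ) (j k : Fin n) :
    edgeTerm (fun w => F (w ∘ π)) w j k = edgeTerm F (w ∘ π) (π.symm j) (π.symm k) := by
  simp [edgeTerm, edgeDeriv_comp_perm hF]

/-- Relabelling the vertices changes neither the variance nor the full edge sum, so the excess term
can be placed on any chosen edge. -/
lemma variance_uniform_le_edgeTerm {n : ℕ} {F : (Fin (n + 2) → ℝ) → ℝ} (hF : ContDiff ℝ 1 F)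
    (π : Equiv.Perm (Fin (n + 2))) :
    ∫ w, F w ^ 2 ∂uniform (n + 1) - (∫ w, F w ∂uniform (n + 1)) ^ 2 ≤
      ∫ w, ((1 / 6) * (∑ k, ∑ j, edgeTerm F w j k) + (1 / 6) * edgeTerm F w (π 0) (π 1))
        ∂uniform (n + 1) := by
  have hFc := hF.continuous
  have hF' : ContDiff ℝ 1 fun w => F (w ∘ π.symm) :=
    hF.comp (contDiff_pi.2 fun i => contDiff_apply ℝ ℝ (π.symm i))
  have h := variance_uniform_le (n + 1) hF'
  rw [integral_perm_uniform π.symm hFc,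
    integral_perm_uniform π.symm (f := fun w => F w ^ 2) (by fun_prop)] at h
  refine h.trans ?_
  have hc : Continuous fun w => (1 / 6) * (∑ k, ∑ j, edgeTerm F w j k) +
      (1 / 6) * edgeTerm F w (π 0) (π 1) := by
    have := continuous_edgeTerm hF
    fun_prop
  rw [← integral_perm_uniform π.symm hc]
  refine integral_mono_ae (integrable_uniform _ (continuous_edgeEnergy hF'))
    (integrable_uniform _ (hc.comp (by fun_prop))) ?_
  filter_upwards [ae_uniform (n + 1)] with w hw
  refine (edgeEnergy_le _ hw.1).trans_eq ?_
  simp only [edgeTerm_comp_perm hF, Equiv.symm_symm]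
  congr 2
  rw [Equiv.sum_comp π fun k => ∑ j, edgeTerm F (w ∘ π.symm) (π j) k]
  exact Finset.sum_congr rfl fun k _ => Equiv.sum_comp π fun j => edgeTerm F (w ∘ π.symm) j k

lemma three_edgeTerms_le {n : ℕ} (F : (Fin (n + 3) → ℝ) → ℝ) {w : Fin (n + 3) → ℝ}
    (hw : ∀ i, 0 ≤ w i) :
    edgeTerm F w 0 1 + edgeTerm F w 0 2 + edgeTerm F w 2 1 ≤
      (1 / 2) * ∑ k, ∑ j, edgeTerm F w j k := by
  rw [sum_sum_eq_two_mul (edgeTerm_comm F w) (edgeTerm_self F w), edgeTerm_comm F w 2 1,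
    ← mul_assoc, show (1 / 2 * 2 : ℝ) = 1 by norm_num, one_mul,
    ← sum_sum_ite_eq (edgeTerm F w) 0 1, ← sum_sum_ite_eq (edgeTerm F w) 0 2,
    ← sum_sum_ite_eq (edgeTerm F w) 1 2, ← Finset.sum_add_distrib, ← Finset.sum_add_distrib]
  refine Finset.sum_le_sum fun k _ => ?_
  rw [← Finset.sum_add_distrib, ← Finset.sum_add_distrib]
  refine Finset.sum_le_sum fun j _ => ?_
  have h0 := edgeTerm_nonneg F hw j k
  have a1 : (1 : Fin (n + 3)) ≠ 2 := by rw [Ne, Fin.ext_iff, Fin.val_one, Fin.val_two]; decide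
  have a2 : (0 : Fin (n + 3)) ≠ 1 := by simp
  have a3 : (0 : Fin (n + 3)) < 1 := by simp
  have a4 : (0 : Fin (n + 3)) < 2 := by rw [Fin.lt_def, Fin.val_zero, Fin.val_two]; decide
  have a5 : (1 : Fin (n + 3)) < 2 := by rw [Fin.lt_def, Fin.val_one, Fin.val_two]; decide
  by_cases b1 : j = 0 ∧ k = 1
  · obtain ⟨rfl, rfl⟩ := b1
    simp [a1, a2]
  by_cases b2 : j = 0 ∧ k = 2
  · obtain ⟨rfl, rfl⟩ := b2
    simp [a1.symm, a2, a4]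
  by_cases b3 : j = 1 ∧ k = 2
  · obtain ⟨rfl, rfl⟩ := b3
    simp [a1.symm, a2.symm, a5]
  simp only [b1, b2, b3, if_false]
  split_ifs <;> linarith

/-- The excess is averaged over the three edges of the triangle 0, 1, 2, which together carry at
most half of the sum over ordered pairs: 1/6 + (1/6)(1/3)(1/2) = 7/36. Without this averaging the
constant would be too large for 1/π². -/
lemma variance_uniform_le_sum_edgeTerm {n : ℕ} {F : (Fin (n + 3) → ℝ) → ℝ}
    (hF : ContDiff ℝ 1 F) :
    ∫ w, F w ^ 2 ∂uniform (n + 2) - (∫ w, F w ∂uniform (n + 2)) ^ 2 ≤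
      ∫ w, (7 / 36) * ∑ k, ∑ j, edgeTerm F w j k ∂uniform (n + 2) := by
  have h1 := variance_uniform_le_edgeTerm hF 1
  have h2 := variance_uniform_le_edgeTerm hF (Equiv.swap 1 2)
  have h3 := variance_uniform_le_edgeTerm hF (Equiv.swap 0 2)
  have a1 : (1 : Fin (n + 3)) ≠ 2 := by rw [Ne, Fin.ext_iff, Fin.val_one, Fin.val_two]; decide
  have a2 : (0 : Fin (n + 3)) ≠ 1 := by simp
  have a3 : (0 : Fin (n + 3)) ≠ 2 := by rw [Ne, Fin.ext_iff, Fin.val_zero, Fin.val_two]; decide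
  rw [Equiv.swap_apply_left, Equiv.swap_apply_of_ne_of_ne a2 a3] at h2
  rw [Equiv.swap_apply_left, Equiv.swap_apply_of_ne_of_ne a2.symm a1] at h3
  simp only [Equiv.Perm.coe_one, id] at h1
  have hc := continuous_edgeTerm hF
  have hi : ∀ j k, Integrable (fun w => (1 / 6) * (∑ k, ∑ j, edgeTerm F w j k) +
      (1 / 6) * edgeTerm F w j k) (uniform (n + 2)) := fun j k =>
    integrable_uniform _ (by fun_prop)
  have h4 : ∫ w, ((1 / 6) * (∑ k, ∑ j, edgeTerm F w j k) + (1 / 6) * edgeTerm F w 0 1)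
        ∂uniform (n + 2) + ∫ w, ((1 / 6) * (∑ k, ∑ j, edgeTerm F w j k) +
        (1 / 6) * edgeTerm F w 0 2) ∂uniform (n + 2) +
      ∫ w, ((1 / 6) * (∑ k, ∑ j, edgeTerm F w j k) + (1 / 6) * edgeTerm F w 2 1)
        ∂uniform (n + 2) ≤
      ∫ w, 3 * ((7 / 36) * ∑ k, ∑ j, edgeTerm F w j k) ∂uniform (n + 2) := by
    rw [← integral_add (hi _ _) (hi _ _), ← integral_add ((hi _ _).fun_add (hi _ _)) (hi _ _)]
    refine integral_mono_ae (((hi _ _).fun_add (hi _ _)).fun_add (hi _ _))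
      (integrable_uniform _ (by fun_prop)) ?_
    filter_upwards [ae_uniform (n + 2)] with w hw
    have := three_edgeTerms_le F hw.1
    linarith
  rw [integral_const_mul] at h4
  change _ + _ + _ ≤ 3 * ∫ w, (7 / 36) * ∑ k, ∑ j, edgeTerm F w j k ∂uniform (n + 2) at h4
  linarith

/-- Popoviciu's inequality for finitely many values. -/
lemma sum_sum_mul_sq_le {n : ℕ} {w g : Fin (n + 1) → ℝ} (hw : w ∈ stdSimplex ℝ (Fin (n + 1)))
    {L : ℝ} (hg : ∀ j k, |g j - g k| ≤ L) :
    ∑ k, ∑ j, w j * w k * (g j - g k) ^ 2 ≤ L ^ 2 / 2 := by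
  obtain ⟨a, ha⟩ := Finite.exists_max g
  obtain ⟨b, hb⟩ := Finite.exists_min g
  -- About the midpoint of the range every deviation is at most L/2; the double sum is twice the
  -- variance, hence at most twice the second moment about c.
  set c := (g a + g b) / 2 with hc
  have hL : g a - g b ≤ L := (le_abs_self _).trans (hg a b)
  have h1 : ∀ j, (g j - c) ^ 2 ≤ L ^ 2 / 4 := by
    intro j
    have h2 := ha j
    have h3 := hb j
    have : |g j - c| ≤ L / 2 := by
      rw [abs_le]; constructor <;> rw [hc] <;> linarith
    calc (g j - c) ^ 2 = |g j - c| ^ 2 := (sq_abs _).symm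
      _ ≤ (L / 2) ^ 2 := pow_le_pow_left₀ (abs_nonneg _) this 2
      _ = L ^ 2 / 4 := by ring
  have h2 : ∑ k, ∑ j, w j * w k * (g j - g k) ^ 2 =
      2 * (∑ j, w j * (g j - c) ^ 2) - 2 * (∑ j, w j * (g j - c)) ^ 2 := by
    have e : ∀ j k, w j * w k * (g j - g k) ^ 2 = w k * (w j * (g j - c) ^ 2) +
        w j * (w k * (g k - c) ^ 2) - 2 * (w k * (g k - c)) * (w j * (g j - c)) :=
      fun j k => by ring
    simp_rw [e, Finset.sum_sub_distrib, Finset.sum_add_distrib, ← Finset.mul_sum,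
      ← Finset.sum_mul, ← Finset.mul_sum, hw.2]
    ring
  have h3 : ∑ j, w j * (g j - c) ^ 2 ≤ ∑ j, w j * (L ^ 2 / 4) :=
    Finset.sum_le_sum fun j _ => mul_le_mul_of_nonneg_left (h1 j) (hw.1 j)
  rw [← Finset.sum_mul, hw.2] at h3
  rw [h2]
  nlinarith [sq_nonneg (∑ j, w j * (g j - c))]

lemma edgeDeriv_bary {n d : ℕ} (p : Fin (n + 1) → E d) {u : E d → ℝ} (hu : ContDiff ℝ 1 u)
    (w : Fin (n + 1) → ℝ) (j k : Fin (n + 1)) :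
    edgeDeriv (fun w => u (bary p w)) w j k =
      fderiv ℝ u (bary p w) (p j) - fderiv ℝ u (bary p w) (p k) := by
  have hb : bary p = LinearMap.toContinuousLinearMap
      (Fintype.linearCombination ℝ p : (Fin (n + 1) → ℝ) →ₗ[ℝ] E d) := by
    funext w; simp [bary, Fintype.linearCombination_apply]
  have h1 := (LinearMap.toContinuousLinearMap
      (Fintype.linearCombination ℝ p : (Fin (n + 1) → ℝ) →ₗ[ℝ] E d)).hasFDerivAt (x := w)
  rw [← hb] at h1
  have h2 := ((hu.differentiable one_ne_zero) (bary p w)).hasFDerivAt.comp w h1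
  have h3 : fderiv ℝ (fun w => u (bary p w)) w = _ := h2.fderiv
  rw [edgeDeriv, h3, ContinuousLinearMap.comp_apply, map_sub, map_sub]
  simp [Fintype.linearCombination_apply_single]

/-- The Poincaré inequality of a simplex of dimension at least two. -/
theorem variance_bary_le {n d : ℕ} (p : Fin (n + 3) → E d) {h : ℝ}
    (hp : ∀ j k, dist (p j) (p k) ≤ h) {u : E d → ℝ} (hu : ContDiff ℝ 1 u) :
    ∫ w, u (bary p w) ^ 2 ∂uniform (n + 2) - (∫ w, u (bary p w) ∂uniform (n + 2)) ^ 2 ≤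
      (h / Real.pi) ^ 2 * ∫ w, ‖fderiv ℝ u (bary p w)‖ ^ 2 ∂uniform (n + 2) := by
  have hF : ContDiff ℝ 1 fun w => u (bary p w) := hu.comp (contDiff_bary p)
  refine (variance_uniform_le_sum_edgeTerm hF).trans ?_
  rw [← integral_const_mul]
  have hc := continuous_edgeTerm hF
  have hfd : Continuous fun w => fderiv ℝ u (bary p w) :=
    (hu.continuous_fderiv one_ne_zero).comp (continuous_bary p)
  refine integral_mono_ae (integrable_uniform _ (by fun_prop))
    (integrable_uniform _ (by fun_prop)) ?_
  filter_upwards [ae_uniform (n + 2)] with w hw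
  have h1 := sum_sum_mul_sq_le (g := fun j => fderiv ℝ u (bary p w) (p j)) hw
    (L := ‖fderiv ℝ u (bary p w)‖ * h) fun j k => by
      rw [← map_sub, ← Real.norm_eq_abs]
      refine (ContinuousLinearMap.le_opNorm _ _).trans ?_
      rw [← dist_eq_norm]
      exact mul_le_mul_of_nonneg_left (hp j k) (norm_nonneg _)
  simp only [edgeTerm, edgeDeriv_bary p hu]
  -- The edge bound 7/36 and the factor 1/2 from Popoviciu give 7/72, which is below 1/10 ≤ 1/π².
  have hpi : Real.pi ^ 2 ≤ 10 := by
    have := Real.pi_lt_d2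
    nlinarith [Real.pi_pos]
  have hpi0 := Real.pi_pos
  have hpi1 : 1 / 10 ≤ 1 / Real.pi ^ 2 := one_div_le_one_div_of_le (by positivity) hpi
  have h0 : 0 ≤ h ^ 2 * ‖fderiv ℝ u (bary p w)‖ ^ 2 := by positivity
  have e : (h / Real.pi) ^ 2 * ‖fderiv ℝ u (bary p w)‖ ^ 2 =
      h ^ 2 * ‖fderiv ℝ u (bary p w)‖ ^ 2 * (1 / Real.pi ^ 2) := by ring
  have h2 := mul_le_mul_of_nonneg_left hpi1 h0
  rw [mul_pow] at h1
  simp only [e]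
  linarith

/-! ### Trace inequalities for smooth functions -/

lemma bary_cone {n d : ℕ} (p : Fin (n + 2) → E d) (t : ℝ) (w : Fin (n + 1) → ℝ) :
    bary p (cone t w) =
      t • bary (fun i => p i.castSucc) w + (1 - t) • p (Fin.last _) := by
  rw [bary, Fin.sum_univ_castSucc, bary, Finset.smul_sum]
  simp [smul_smul]

lemma norm_bary_sub_le {n d : ℕ} (p : Fin (n + 1) → E d) {h : ℝ}
    (hp : ∀ j k, dist (p j) (p k) ≤ h) {w : Fin (n + 1) → ℝ}
    (hw : w ∈ stdSimplex ℝ (Fin (n + 1))) (i : Fin (n + 1)) : ‖bary p w - p i‖ ≤ h := by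
  have : bary p w - p i = ∑ j, w j • (p j - p i) := by
    simp only [smul_sub, Finset.sum_sub_distrib, ← Finset.sum_smul, hw.2, one_smul, bary]
  rw [this]
  calc ‖∑ j, w j • (p j - p i)‖ ≤ ∑ j, ‖w j • (p j - p i)‖ := norm_sum_le _ _
    _ ≤ ∑ j, w j * h := Finset.sum_le_sum fun j _ => by
        rw [norm_smul, Real.norm_of_nonneg (hw.1 j), ← dist_eq_norm]
        exact mul_le_mul_of_nonneg_left (hp j i) (hw.1 j)
    _ = h := by rw [← Finset.sum_mul, hw.2, one_mul]

/-- The integrand times the density is the derivative of t^(n+1) f(t). This is the trace identity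
along one ray. -/
lemma integral_powerLaw_add_deriv (n : ℕ) {f : ℝ → ℝ} (hf : ContDiff ℝ 1 f) :
    ∫ t, (f t + t * deriv f t / (n + 1)) ∂powerLaw n = f 1 := by
  rw [integral_powerLaw]
  have hc := hf.continuous_deriv le_rfl
  have hfc := hf.continuous
  have hn : (n : ℝ) + 1 ≠ 0 := by positivity
  rw [intervalIntegral.integral_eq_sub_of_hasDerivAt (f := fun t => t ^ (n + 1) * f t)]
  · simp
  · intro t _
    have := (hasDerivAt_pow (n + 1) t).mul ((hf.differentiable one_ne_zero) t).hasDerivAt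
    refine this.congr_deriv ?_
    rw [Nat.add_sub_cancel]
    push_cast
    field_simp
    ring
  · exact Continuous.intervalIntegrable (by fun_prop) _ _

/-- The trace identity of a simplex. -/
lemma integral_facet_eq {n d : ℕ} (p : Fin (n + 2) → E d) {u : E d → ℝ} (hu : ContDiff ℝ 1 u) :
    ∫ w, u (bary (fun i => p i.castSucc) w) ∂uniform n =
      ∫ w, (u (bary p w) + fderiv ℝ u (bary p w) (bary p w - p (Fin.last _)) / (n + 1))
        ∂uniform (n + 1) := by
  have hfd : Continuous (fderiv ℝ u) := hu.continuous_fderiv one_ne_zero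
  have hb := continuous_bary p
  have huc := hu.continuous
  have hc : Continuous fun w => u (bary p w) +
      fderiv ℝ u (bary p w) (bary p w - p (Fin.last _)) / (n + 1) := by
    have : Continuous fun w => fderiv ℝ u (bary p w) (bary p w - p (Fin.last _)) :=
      (hfd.comp hb).clm_apply (hb.sub continuous_const)
    fun_prop
  have hi := integrable_powerLaw_prod_uniform n (hc.comp continuous_cone)
  simp only [Function.comp_def] at hi
  rw [integral_uniform_succ n hc, integral_prod_symm _ hi]
  congr 1
  funext w
  -- For fixed w the ray runs from the opposite vertex at t = 0 to the facet at t = 1, and t times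
  -- its velocity is the position relative to that vertex.
  have hline : ContDiff ℝ 1 fun t : ℝ =>
      u (t • bary (fun i => p i.castSucc) w + (1 - t) • p (Fin.last _)) :=
    hu.comp (by fun_prop)
  have h := integral_powerLaw_add_deriv n hline
  simp only [one_smul, sub_self, zero_smul, add_zero] at h
  rw [← h]
  congr 1
  funext t
  rw [bary_cone]
  have h1 : HasDerivAt (fun t : ℝ =>
      t • bary (fun i => p i.castSucc) w + (1 - t) • p (Fin.last _))
      (bary (fun i => p i.castSucc) w - p (Fin.last _)) t := by
    have := ((hasDerivAt_id t).smul_const (bary (fun i => p i.castSucc) w)).add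
      (((hasDerivAt_id t).const_sub 1).smul_const (p (Fin.last _)))
    refine this.congr_deriv ?_
    simp [sub_eq_add_neg]
  have h2 : deriv (fun t : ℝ =>
      u (t • bary (fun i => p i.castSucc) w + (1 - t) • p (Fin.last _))) t = _ :=
    (((hu.differentiable one_ne_zero) _).hasFDerivAt.comp_hasDerivAt t h1).deriv
  rw [h2, ← smul_eq_mul t, ← map_smul]
  congr 3
  simp only [smul_sub, sub_smul, one_smul]
  abel

/-- The trace identity for u², whose derivative term 2u ∇u·(x - p) is at most h(s u² + |∇u|²/s). The
parameter s stays free because the two final bounds need different values. -/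
lemma integral_facet_sq_le {n d : ℕ} (p : Fin (n + 2) → E d) {h : ℝ}
    (hp : ∀ j k, dist (p j) (p k) ≤ h) {u : E d → ℝ} (hu : ContDiff ℝ 1 u) {s : ℝ} (hs : 0 < s) :
    ∫ w, u (bary (fun i => p i.castSucc) w) ^ 2 ∂uniform n ≤
      ∫ w, u (bary p w) ^ 2 ∂uniform (n + 1) +
        h / (n + 1) * (s * ∫ w, u (bary p w) ^ 2 ∂uniform (n + 1) +
          (∫ w, ‖fderiv ℝ u (bary p w)‖ ^ 2 ∂uniform (n + 1)) / s) := by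
  have hfd : Continuous fun w => fderiv ℝ u (bary p w) :=
    (hu.continuous_fderiv one_ne_zero).comp (continuous_bary p)
  have hb := continuous_bary p
  have huc := hu.continuous
  have i1 : Integrable (fun w => u (bary p w) ^ 2) (uniform (n + 1)) :=
    integrable_uniform _ (by fun_prop)
  have i2 : Integrable (fun w => ‖fderiv ℝ u (bary p w)‖ ^ 2) (uniform (n + 1)) :=
    integrable_uniform _ (by fun_prop)
  rw [integral_facet_eq p (u := fun x => u x ^ 2) (hu.pow 2), ← integral_const_mul s,
    ← integral_div, ← integral_add (i1.const_mul s) (i2.div_const s), ← integral_const_mul,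
    ← integral_add i1 (((i1.const_mul s).fun_add (i2.div_const s)).const_mul _)]
  have hd : ∀ x v, fderiv ℝ (fun x => u x ^ 2) x v = 2 * u x * fderiv ℝ u x v := by
    intro x v
    rw [fderiv_fun_pow 2 ((hu.differentiable one_ne_zero) x)]
    simp
  simp only [hd]
  have hc : Continuous fun w => fderiv ℝ u (bary p w) (bary p w - p (Fin.last _)) :=
    hfd.clm_apply (hb.sub continuous_const)
  refine integral_mono_ae (integrable_uniform _ (by fun_prop))
    (integrable_uniform _ (by fun_prop)) ?_
  filter_upwards [ae_uniform (n + 1)] with w hw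
  have h0 : 0 ≤ h := dist_nonneg.trans (hp 0 0)
  have h1 : |fderiv ℝ u (bary p w) (bary p w - p (Fin.last _))| ≤
      ‖fderiv ℝ u (bary p w)‖ * h := by
    rw [← Real.norm_eq_abs]
    exact (ContinuousLinearMap.le_opNorm _ _).trans
      (mul_le_mul_of_nonneg_left (norm_bary_sub_le p hp hw _) (norm_nonneg _))
  set N := ‖fderiv ℝ u (bary p w)‖
  set U := u (bary p w)
  have h2 : 2 * U * fderiv ℝ u (bary p w) (bary p w - p (Fin.last _)) ≤
      h * (s * U ^ 2 + N ^ 2 / s) := by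
    calc 2 * U * fderiv ℝ u (bary p w) (bary p w - p (Fin.last _))
        ≤ |2 * U * fderiv ℝ u (bary p w) (bary p w - p (Fin.last _))| := le_abs_self _
      _ = 2 * |U| * |fderiv ℝ u (bary p w) (bary p w - p (Fin.last _))| := by
        rw [abs_mul, abs_mul, abs_two]
      _ ≤ 2 * |U| * (N * h) := mul_le_mul_of_nonneg_left h1 (by positivity)
      _ = h * (2 * |U| * N) := by ring
      _ ≤ h * (s * U ^ 2 + N ^ 2 / s) := by
        refine mul_le_mul_of_nonneg_left ?_ h0
        have h3 : s * U ^ 2 + N ^ 2 / s - 2 * |U| * N = (s * |U| - N) ^ 2 / s := by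
          rw [← sq_abs U]; field_simp; ring
        have h4 : 0 ≤ (s * |U| - N) ^ 2 / s := by positivity
        linarith
  have h5 : (0 : ℝ) < n + 1 := by positivity
  have h6 := div_le_div_of_nonneg_right h2 h5.le
  rw [div_mul_eq_mul_div]
  linarith

/-- The trace inequality for smooth functions. -/
theorem integral_facet_sq_le_energy {n d : ℕ} (p : Fin (n + 2) → E d) {h κ : ℝ} (hh : 0 < h)
    (hκ : 0 < κ) (hp : ∀ j k, dist (p j) (p k) ≤ h) {u : E d → ℝ} (hu : ContDiff ℝ 1 u) :
    ∫ w, u (bary (fun i => p i.castSucc) w) ^ 2 ∂uniform n ≤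
      1 / (n + 1) * (1 / κ) * √((2 * h) ^ 2 + ((n + 1) / κ) ^ 2) *
        (∫ w, ‖fderiv ℝ u (bary p w)‖ ^ 2 ∂uniform (n + 1) +
          κ ^ 2 * ∫ w, u (bary p w) ^ 2 ∂uniform (n + 1)) := by
  set R := √((2 * h) ^ 2 + ((n + 1) / κ) ^ 2)
  have hn : (0 : ℝ) < n + 1 := by positivity
  have hR2 : R ^ 2 = (2 * h) ^ 2 + ((n + 1) / κ) ^ 2 := Real.sq_sqrt (by positivity)
  have hR : 0 < R := Real.sqrt_pos.2 (by positivity)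
  -- This s gives the gradient term exactly the coefficient of the claim; it remains to compare the
  -- coefficients of the mean of u².
  refine (integral_facet_sq_le p hp hu (s := h * κ / R) (by positivity)).trans ?_
  set A := ∫ w, u (bary p w) ^ 2 ∂uniform (n + 1)
  set B := ∫ w, ‖fderiv ℝ u (bary p w)‖ ^ 2 ∂uniform (n + 1)
  have hA : 0 ≤ A := integral_nonneg fun _ => sq_nonneg _
  -- The tangent bound √(a² + b²) ≤ a + b²/(2a), with a = (n+1)/κ and b = 2h.
  have hRle : R ≤ (n + 1) / κ + 2 * h ^ 2 * κ / (n + 1) := by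
    refine Real.sqrt_le_iff.2 ⟨by positivity, ?_⟩
    have : ((n + 1) / κ + 2 * h ^ 2 * κ / (n + 1)) ^ 2 =
        (2 * h) ^ 2 + ((n + 1) / κ) ^ 2 + (2 * h ^ 2 * κ / (n + 1)) ^ 2 := by
      field_simp; ring
    rw [this]
    have : 0 ≤ (2 * h ^ 2 * κ / ((n : ℝ) + 1)) ^ 2 := sq_nonneg _
    linarith
  have e1 : h / (n + 1) * (h * κ / R * A + B / (h * κ / R)) =
      h ^ 2 * κ / ((n + 1) * R) * A + 1 / (n + 1) * (1 / κ) * R * B := by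
    field_simp
  have e2 : 1 / (n + 1) * (1 / κ) * R * (B + κ ^ 2 * A) =
      1 / (n + 1) * (1 / κ) * R * B + R * κ / (n + 1) * A := by
    field_simp
  rw [e1, e2]
  have h1 : 1 + h ^ 2 * κ / ((n + 1) * R) ≤ R * κ / (n + 1) := by
    have h2 : (n + 1) * R ≤ (n + 1) ^ 2 / κ + 2 * h ^ 2 * κ := by
      have := mul_le_mul_of_nonneg_left hRle hn.le
      refine this.trans_eq ?_
      field_simp
    have h3 : R ^ 2 * κ = 4 * h ^ 2 * κ + (n + 1) ^ 2 / κ := by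
      rw [hR2]; field_simp; ring
    have h4 : R * κ / (n + 1) - (1 + h ^ 2 * κ / ((n + 1) * R)) =
        (R ^ 2 * κ - (n + 1) * R - h ^ 2 * κ) / ((n + 1) * R) := by
      field_simp; ring
    have h5 : 0 ≤ (R ^ 2 * κ - (n + 1) * R - h ^ 2 * κ) / ((n + 1) * R) := by
      refine div_nonneg ?_ (by positivity)
      have : 0 ≤ h ^ 2 * κ := by positivity
      linarith
    linarith
  have := mul_le_mul_of_nonneg_right h1 hA
  linarith

lemma minScale_pos {h κ : ℝ} (hh : 0 < h) (hκ : 0 ≤ κ) : 0 < minScale h κ := by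
  have := Real.pi_pos
  unfold minScale
  split_ifs with h0
  · positivity
  · have : 0 < κ := lt_of_le_of_ne hκ (Ne.symm h0)
    exact lt_min (by positivity) (by positivity)

lemma integral_sub_const_sq {Ω : Type*} [MeasurableSpace Ω] {μ : Measure Ω}
    [IsProbabilityMeasure μ] {f : Ω → ℝ} (hf : Integrable f μ)
    (hf2 : Integrable (fun x => f x ^ 2) μ) (c : ℝ) :
    ∫ x, (f x - c) ^ 2 ∂μ =
      (∫ x, f x ^ 2 ∂μ - (∫ x, f x ∂μ) ^ 2) + (∫ x, f x ∂μ - c) ^ 2 := by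
  have : ∀ x, (f x - c) ^ 2 = f x ^ 2 - 2 * c * f x + c ^ 2 := fun x => by ring
  simp_rw [this]
  rw [integral_add (by fun_prop) (integrable_const _),
    integral_sub hf2 (hf.const_mul _), integral_const_mul]
  simp
  ring

/-- The mean-free trace inequality for smooth functions. -/
theorem integral_facet_sub_mean_sq_le {n d : ℕ} (p : Fin (n + 2) → E d) {h κ : ℝ} (hh : 0 < h)
    (hκ : 0 ≤ κ) (hp : ∀ j k, dist (p j) (p k) ≤ h) {u : E d → ℝ} (hu : ContDiff ℝ 1 u) :
    ∫ w, (u (bary (fun i => p i.castSucc) w) -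
        ∫ w', u (bary (fun i => p i.castSucc) w') ∂uniform n) ^ 2 ∂uniform n ≤
      1 / (n + 1) * minScale h κ * (2 * h + (n + 1) * minScale h κ) *
        (∫ w, ‖fderiv ℝ u (bary p w)‖ ^ 2 ∂uniform (n + 1) +
          κ ^ 2 * ∫ w, u (bary p w) ^ 2 ∂uniform (n + 1)) := by
  have hm := minScale_pos hh hκ
  set m := minScale h κ with hmdef
  set A := ∫ w, u (bary p w) ^ 2 ∂uniform (n + 1)
  set B := ∫ w, ‖fderiv ℝ u (bary p w)‖ ^ 2 ∂uniform (n + 1)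
  have hA : 0 ≤ A := integral_nonneg fun _ => sq_nonneg _
  have hB : 0 ≤ B := integral_nonneg fun _ => sq_nonneg _
  have huc := hu.continuous
  have hb := continuous_bary p
  have hb' := continuous_bary fun i => p (Fin.castSucc i)
  -- For d = 1 the facet is a point and the left side vanishes, so the Poincaré inequality is used
  -- only in dimension at least two.
  rcases n with _ | n
  · simp only [uniform, integral_dirac, sub_self]
    rw [zero_pow two_ne_zero]
    positivity
  have i1 : Integrable (fun w => u (bary p w)) (uniform (n + 1 + 1)) :=
    integrable_uniform _ (by fun_prop)
  have i2 : Integrable (fun w => u (bary p w) ^ 2) (uniform (n + 1 + 1)) :=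
    integrable_uniform _ (by fun_prop)
  have j1 : Integrable (fun w => u (bary (fun i => p i.castSucc) w)) (uniform (n + 1)) :=
    integrable_uniform _ (by fun_prop)
  have j2 : Integrable (fun w => u (bary (fun i => p i.castSucc) w) ^ 2) (uniform (n + 1)) :=
    integrable_uniform _ (by fun_prop)
  set c := ∫ w, u (bary p w) ∂uniform (n + 1 + 1) with hcdef
  have hmean := integral_sub_const_sq j1 j2 c
  have hmean' := integral_sub_const_sq j1 j2
    (∫ w', u (bary (fun i => p i.castSucc) w') ∂uniform (n + 1))
  rw [sub_self, zero_pow two_ne_zero, add_zero] at hmean'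
  -- With s = 1/m the variance bound m²N below makes both terms in the bracket at most mN, where N
  -- is the mean energy density.
  have h1 := integral_facet_sq_le p hp (u := fun x => u x - c) (hu.sub contDiff_const)
    (s := 1 / m) (by positivity)
  simp only [fderiv_sub_const] at h1
  rw [integral_sub_const_sq i1 i2 c, ← hcdef, sub_self, zero_pow two_ne_zero, add_zero] at h1
  change _ ≤ (A - c ^ 2) + h / _ * (1 / m * (A - c ^ 2) + B / (1 / m)) at h1
  -- If m = h/π this is the Poincaré inequality; if m = 1/κ it suffices that the variance is at most
  -- the mean of u².
  have hvar : A - c ^ 2 ≤ m ^ 2 * (B + κ ^ 2 * A) := by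
    have hP : A - c ^ 2 ≤ (h / Real.pi) ^ 2 * B := variance_bary_le p hp hu
    have hpi := Real.pi_pos
    have hκA : 0 ≤ κ ^ 2 * A := by positivity
    have hP' : A - c ^ 2 ≤ (h / Real.pi) ^ 2 * (B + κ ^ 2 * A) :=
      hP.trans (mul_le_mul_of_nonneg_left (by linarith) (sq_nonneg _))
    rw [hmdef, minScale]
    split_ifs with h0
    · exact hP'
    · rcases min_choice (h / Real.pi) (1 / κ) with hc | hc
      · rwa [hc]
      · rw [hc]
        have e : (1 / κ) ^ 2 * (B + κ ^ 2 * A) = (1 / κ) ^ 2 * B + A := by field_simp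
        have : 0 ≤ (1 / κ) ^ 2 * B := by positivity
        rw [e]
        linarith [sq_nonneg c]
  set N := B + κ ^ 2 * A
  have hBN : B ≤ N := by
    have : 0 ≤ κ ^ 2 * A := by positivity
    simp only [N]; linarith
  have hn : (0 : ℝ) < ((n + 1 : ℕ) : ℝ) + 1 := by positivity
  have h2 : 1 / m * (A - c ^ 2) + B / (1 / m) ≤ 2 * m * N := by
    have k1 : 1 / m * (A - c ^ 2) ≤ 1 / m * (m ^ 2 * N) :=
      mul_le_mul_of_nonneg_left hvar (by positivity)
    have k2 : 1 / m * (m ^ 2 * N) = m * N := by field_simp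
    have k3 : B / (1 / m) = m * B := by field_simp
    have k4 : m * B ≤ m * N := mul_le_mul_of_nonneg_left hBN hm.le
    linarith
  have h3 := mul_le_mul_of_nonneg_left h2 (div_nonneg hh.le hn.le)
  have e : 1 / (((n + 1 : ℕ) : ℝ) + 1) * m * (2 * h + (((n + 1 : ℕ) : ℝ) + 1) * m) * N =
      m ^ 2 * N + h / (((n + 1 : ℕ) : ℝ) + 1) * (2 * m * N) := by
    field_simp; ring
  rw [e]
  linarith [sq_nonneg (∫ w', u (bary (fun i => p i.castSucc) w') ∂uniform (n + 1) - c)]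

/-! ### Averages over contracted copies -/

lemma eLpNorm_two_sq {α F : Type*} [MeasurableSpace α] [NormedAddCommGroup F] (f : α → F)
    (μ : Measure α) : eLpNorm f 2 μ ^ 2 = ∫⁻ x, ‖f x‖ₑ ^ 2 ∂μ := by
  have := eLpNorm_nnreal_pow_eq_lintegral (f := f) (μ := μ) (p := 2) two_ne_zero
  simpa using this

lemma eLpNorm_integral_le {α β F : Type*} [MeasurableSpace α] [MeasurableSpace β]
    [NormedAddCommGroup F] [NormedSpace ℝ F] {μ : Measure α} {ν : Measure β} [SFinite μ]
    [IsProbabilityMeasure ν] {f : α × β → F} (hf : AEStronglyMeasurable f (μ.prod ν)) :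
    eLpNorm (fun x => ∫ y, f (x, y) ∂ν) 2 μ ≤ eLpNorm f 2 (μ.prod ν) := by
  have h : eLpNorm (fun x => ∫ y, f (x, y) ∂ν) 2 μ ^ 2 ≤ eLpNorm f 2 (μ.prod ν) ^ 2 := by
    rw [eLpNorm_two_sq, eLpNorm_two_sq, lintegral_prod _ (hf.enorm.pow_const 2)]
    refine lintegral_mono_ae ?_
    filter_upwards [hf.prodMk_left] with x hx
    rw [← eLpNorm_two_sq fun y => f (x, y)]
    refine pow_le_pow_left' ?_ 2
    calc ‖∫ y, f (x, y) ∂ν‖ₑ ≤ ∫⁻ y, ‖f (x, y)‖ₑ ∂ν := enorm_integral_le_lintegral_enorm _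
      _ = eLpNorm (fun y => f (x, y)) 1 ν := eLpNorm_one_eq_lintegral_enorm.symm
      _ ≤ eLpNorm (fun y => f (x, y)) 2 ν :=
        eLpNorm_le_eLpNorm_of_exponent_le one_le_two hx
  exact (ENNReal.pow_le_pow_left_iff two_ne_zero).1 h

/-- The point dividing a segment in the ratio `ε : 1 - ε`. -/
def blend {d : ℕ} (ε : ℝ) (q : E d × E d) : E d := (1 - ε) • q.1 + ε • q.2

lemma continuous_blend {d : ℕ} (ε : ℝ) : Continuous (blend (d := d) ε) := by
  unfold blend; fun_prop

/-- Since 1 - ε ≥ 1/2, undoing the contraction multiplies volumes by at most 2^d. The bound does not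
depend on ε, so the averaging operators are uniformly bounded on L². -/
lemma map_blend_le {d : ℕ} {ν : Measure (E d)} [IsProbabilityMeasure ν] (Ω : Set (E d))
    {ε : ℝ} (hε : ε ∈ Set.Icc (0 : ℝ) (1 / 2)) :
    ((volume.restrict Ω).prod ν).map (blend ε) ≤ (2 ^ d : ENNReal) • volume := by
  refine Measure.le_intro fun S hS _ => ?_
  have hm := (continuous_blend (d := d) ε).measurable
  have h0 : 0 < 1 - ε := by linarith [hε.2]
  rw [Measure.map_apply hm hS, Measure.prod_apply_symm (hm hS), Measure.smul_apply, smul_eq_mul]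
  calc ∫⁻ y, volume.restrict Ω ((fun x => (x, y)) ⁻¹' (blend ε ⁻¹' S)) ∂ν
      ≤ ∫⁻ _, 2 ^ d * volume S ∂ν := by
        refine lintegral_mono fun y => (Measure.restrict_apply_le _ _).trans ?_
        have e : (fun x => (x, y)) ⁻¹' (blend ε ⁻¹' S) =
            (fun x : E d => (1 - ε) • x) ⁻¹' ((fun x => x + ε • y) ⁻¹' S) := rfl
        rw [e, Measure.addHaar_preimage_smul _ h0.ne', measure_preimage_add_right,
          finrank_euclideanSpace_fin]
        gcongr
        rw [abs_of_nonneg (by positivity), ← inv_pow, ENNReal.ofReal_pow (by positivity)]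
        gcongr
        rw [← ENNReal.ofReal_ofNat 2]
        refine ENNReal.ofReal_le_ofReal ?_
        rw [inv_le_comm₀ h0 two_pos]
        linarith [hε.2]
    _ = 2 ^ d * volume S := by simp

/-- Averages over contracted copies converge in `L²`. -/
lemma tendsto_eLpNorm_average {d : ℕ} {F : Type*} [NormedAddCommGroup F] [NormedSpace ℝ F]
    [CompleteSpace F]
    {ν : Measure (E d)} [IsProbabilityMeasure ν] {Ω : Set (E d)} (hΩm : MeasurableSet Ω)
    {R : ℝ} (hΩ : ∀ x ∈ Ω, ‖x‖ ≤ R) (hν : ∀ᵐ y ∂ν, ‖y‖ ≤ R) {g : E d → F}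
    (hg : MemLp g 2 volume) {ε : ℕ → ℝ} (hε : ∀ n, ε n ∈ Set.Icc (0 : ℝ) (1 / 2))
    (hε0 : Tendsto ε atTop (𝓝 0))
    (hint : ∀ n x, Integrable (fun y => g (blend (ε n) (x, y))) ν) :
    Tendsto (fun n => eLpNorm (fun x => ∫ y, g (blend (ε n) (x, y)) ∂ν - g x) 2
      (volume.restrict Ω)) atTop (𝓝 0) := by
  have hvol : volume Ω ≠ ⊤ :=
    ((Metric.isBounded_closedBall (x := (0 : E d)) (r := R)).subset fun x hx => by
      simpa using hΩ x hx).measure_lt_top.ne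
  have : IsFiniteMeasure (volume.restrict Ω) := isFiniteMeasure_restrict.2 hvol
  set μ := (volume.restrict Ω).prod ν
  have hac : ∀ n, μ.map (blend (ε n)) ≪ volume := fun n =>
    (Measure.absolutelyContinuous_of_le (map_blend_le Ω (hε n))).trans
      (Measure.smul_absolutelyContinuous)
  have hfst : μ.map Prod.fst = volume.restrict Ω := by
    simp [μ, Measure.map_fst_prod]
  have hmeas : ∀ {f : E d → F}, AEStronglyMeasurable f volume → ∀ n,
      AEStronglyMeasurable (fun q => f (blend (ε n) q)) μ := fun hf n =>
    (hf.mono_ac (hac n)).comp_measurable (continuous_blend _).measurable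
  have hmeas' : ∀ {f : E d → F}, AEStronglyMeasurable f volume →
      AEStronglyMeasurable (fun q : E d × E d => f q.1) μ := fun hf =>
    (hf.mono_measure Measure.restrict_le_self).comp_fst
  set C : ENNReal := (2 ^ d) ^ (2⁻¹ : ℝ)
  have hC : C ≠ ⊤ := ENNReal.rpow_ne_top_of_nonneg (by norm_num) (by simp)
  have hbound : ∀ {f : E d → F}, AEStronglyMeasurable f volume → ∀ n,
      eLpNorm (fun q => f (blend (ε n) q)) 2 μ ≤ C * eLpNorm f 2 volume := by
    intro f hf n
    change eLpNorm (f ∘ blend (ε n)) 2 μ ≤ _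
    rw [← eLpNorm_map_measure (hf.mono_ac (hac n)) (continuous_blend _).aemeasurable]
    refine (eLpNorm_mono_measure _ (map_blend_le Ω (hε n))).trans ?_
    rw [eLpNorm_smul_measure_of_ne_top (by simp)]
    simp [C]
  have hbound' : ∀ {f : E d → F}, AEStronglyMeasurable f volume →
      eLpNorm (fun q : E d × E d => f q.1) 2 μ ≤ eLpNorm f 2 volume := by
    intro f hf
    change eLpNorm (f ∘ Prod.fst) 2 μ ≤ _
    rw [← eLpNorm_map_measure (by rw [hfst]; exact hf.mono_measure Measure.restrict_le_self)
      measurable_fst.aemeasurable, hfst]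
    exact eLpNorm_mono_measure _ Measure.restrict_le_self
  rw [ENNReal.tendsto_nhds_zero]
  intro η hη
  rcases eq_or_ne η ⊤ with rfl | hηt
  · simp
  have hC1 : C + 1 ≠ ⊤ := by simp [hC]
  have hC0 : C + 1 ≠ 0 := by simp
  -- The error g - ψ enters twice, under the contraction with factor C and unmoved with factor 1;
  -- hence the division by C + 1.
  obtain ⟨ψ, hψc, hψ, hψcont, hψLp⟩ := hg.exists_hasCompactSupport_eLpNorm_sub_le
    ENNReal.ofNat_ne_top (ε := η / 2 / (C + 1))
    (ENNReal.div_ne_zero.2 ⟨ENNReal.div_ne_zero.2 ⟨hη.ne', by simp⟩, hC1⟩)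
  have huc : UniformContinuous ψ := hψc.uniformContinuous_of_continuous hψcont
  set M : ENNReal := μ Set.univ ^ (2 : ENNReal).toReal⁻¹
  have hM : M ≠ ⊤ := ENNReal.rpow_ne_top_of_nonneg (by norm_num) (measure_ne_top _ _)
  obtain ⟨δ, hδ0, hδ⟩ : ∃ δ : ℝ, 0 < δ ∧ M * ENNReal.ofReal δ ≤ η / 2 := by
    have h1 : Tendsto (fun δ : ℝ => M * ENNReal.ofReal δ) (𝓝[>] 0) (𝓝 0) := by
      have h2 : Tendsto (fun δ : ℝ => ENNReal.ofReal δ) (𝓝[>] 0) (𝓝 0) := by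
        have := (ENNReal.continuous_ofReal.tendsto 0).mono_left
          (nhdsWithin_le_nhds (s := Set.Ioi 0))
        simpa using this
      simpa using ENNReal.Tendsto.const_mul h2 (Or.inr hM)
    have h3 := (ENNReal.tendsto_nhds_zero.1 h1) (η / 2) (ENNReal.half_pos hη.ne')
    obtain ⟨δ, h4, h5⟩ := (h3.and self_mem_nhdsWithin).exists
    exact ⟨δ, h5, h4⟩
  obtain ⟨τ, hτ0, hτ⟩ := Metric.uniformContinuous_iff.1 huc δ hδ0
  have hsmall : ∀ᶠ n in atTop, ε n * (2 * R) < τ := by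
    have : Tendsto (fun n => ε n * (2 * R)) atTop (𝓝 (0 * (2 * R))) := hε0.mul_const _
    rw [zero_mul] at this
    exact this.eventually_lt_const hτ0
  filter_upwards [hsmall] with n hn
  have haeμ : ∀ᵐ q ∂μ, q.1 ∈ Ω ∧ ‖q.2‖ ≤ R := by
    have h1 : ∀ᵐ q ∂μ, q.1 ∈ Ω :=
      Measure.quasiMeasurePreserving_fst.ae (ae_restrict_mem hΩm)
    have h2 : ∀ᵐ q ∂μ, ‖q.2‖ ≤ R := Measure.quasiMeasurePreserving_snd.ae hν
    exact h1.and h2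
  have hψd : eLpNorm (fun q : E d × E d => ψ (blend (ε n) q) - ψ q.1) 2 μ ≤ η / 2 := by
    refine (eLpNorm_le_of_ae_bound (C := δ) ?_).trans hδ
    filter_upwards [haeμ] with q hq
    rw [← dist_eq_norm]
    refine (hτ ?_).le
    have e : blend (ε n) q - q.1 = ε n • (q.2 - q.1) := by
      simp only [blend, sub_smul, one_smul, smul_sub]; abel
    rw [dist_eq_norm, e, norm_smul, Real.norm_of_nonneg (hε n).1]
    refine lt_of_le_of_lt (mul_le_mul_of_nonneg_left ?_ (hε n).1) hn
    have := hΩ q.1 hq.1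
    linarith [norm_sub_le q.2 q.1, hq.2]
  have e1 : (fun x => ∫ y, g (blend (ε n) (x, y)) ∂ν - g x) =
      fun x => ∫ y, (g (blend (ε n) (x, y)) - g x) ∂ν := by
    funext x
    rw [integral_sub (hint n x) (integrable_const _)]
    simp
  have hgm := hg.aestronglyMeasurable
  have hψm := hψLp.aestronglyMeasurable
  rw [e1]
  refine (eLpNorm_integral_le (f := fun q : E d × E d => g (blend (ε n) q) - g q.1)
    ((hmeas hgm n).sub (hmeas' hgm))).trans ?_
  have e2 : (fun q : E d × E d => g (blend (ε n) q) - g q.1) =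
      ((fun q => (g - ψ) (blend (ε n) q)) + (fun q => ψ (blend (ε n) q) - ψ q.1)) -
        fun q => (g - ψ) q.1 := by
    funext q; simp
  rw [e2]
  have m1 := hmeas (hgm.sub hψm) n
  have m2 := (hmeas hψm n).sub (hmeas' hψm)
  have m3 := hmeas' (hgm.sub hψm)
  refine (eLpNorm_sub_le (m1.add m2) m3 one_le_two).trans ?_
  refine (add_le_add (eLpNorm_add_le m1 m2 one_le_two) le_rfl).trans ?_
  refine (add_le_add (add_le_add (hbound (hgm.sub hψm) n) hψd) (hbound' (hgm.sub hψm))).trans ?_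
  calc C * eLpNorm (g - ψ) 2 volume + η / 2 + eLpNorm (g - ψ) 2 volume
      = (C + 1) * eLpNorm (g - ψ) 2 volume + η / 2 := by ring
    _ ≤ (C + 1) * (η / 2 / (C + 1)) + η / 2 := by gcongr
    _ = η := by rw [ENNReal.mul_div_cancel hC0 hC1, ENNReal.add_halves]

/-! ### Density of smooth functions -/

/-- The probability measure whose density is a normalised bump function. -/
def bumpLaw {d : ℕ} {c : E d} (φ : ContDiffBump c) : Measure (E d) :=
  volume.withDensity fun y => ENNReal.ofReal (φ.normed volume y)

section bump

variable {d : ℕ} {c : E d} (φ : ContDiffBump c)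

instance : IsProbabilityMeasure (bumpLaw φ) := by
  constructor
  rw [bumpLaw, withDensity_apply _ .univ, Measure.restrict_univ,
    ← ofReal_integral_eq_lintegral_ofReal φ.integrable_normed (.of_forall φ.nonneg_normed),
    φ.integral_normed, ENNReal.ofReal_one]

lemma integral_bumpLaw {F : Type*} [NormedAddCommGroup F] [NormedSpace ℝ F] (f : E d → F) :
    ∫ y, f y ∂bumpLaw φ = ∫ y, φ.normed volume y • f y := by
  rw [bumpLaw, integral_withDensity_eq_integral_toReal_smul
    (φ.continuous_normed.measurable.ennreal_ofReal) (by simp)]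
  simp only [ENNReal.toReal_ofReal (φ.nonneg_normed _)]

lemma ae_bumpLaw : ∀ᵐ y ∂bumpLaw φ, y ∈ Metric.closedBall c φ.rOut := by
  rw [bumpLaw, ae_withDensity_iff φ.continuous_normed.measurable.ennreal_ofReal]
  refine .of_forall fun y hy => ?_
  rw [← φ.tsupport_normed_eq (μ := volume)]
  refine subset_tsupport _ fun h => hy ?_
  rw [h, ENNReal.ofReal_zero]

lemma exists_bumpLaw_le : ∃ M : ENNReal, M ≠ ⊤ ∧ bumpLaw φ ≤ M • volume := by
  obtain ⟨M, hM⟩ := φ.hasCompactSupport_normed (μ := volume) |>.exists_bound_of_continuous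
    φ.continuous_normed
  refine ⟨ENNReal.ofReal M, ENNReal.ofReal_ne_top, ?_⟩
  rw [bumpLaw, ← withDensity_const]
  exact withDensity_mono (.of_forall fun y => ENNReal.ofReal_le_ofReal
    ((le_abs_self _).trans (hM y)))

lemma integrable_bumpLaw {F : Type*} [NormedAddCommGroup F] {g : E d → F}
    (hg : MemLp g 2 volume) {ε : ℝ} (hε : 0 < ε) (x : E d) :
    Integrable (fun y => g (blend ε (x, y))) (bumpLaw φ) := by
  obtain ⟨M, hM, hle⟩ := exists_bumpLaw_le φ
  have hc : Continuous fun y => blend ε (x, y) := (continuous_blend ε).comp (by fun_prop)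
  have hmap : (bumpLaw φ).map (fun y => blend ε (x, y)) ≤
      (M * ENNReal.ofReal |(ε ^ d)⁻¹|) • volume := by
    refine Measure.le_intro fun S hS _ => ?_
    rw [Measure.map_apply hc.measurable hS]
    refine (hle _).trans_eq ?_
    have e : (fun y => blend ε (x, y)) ⁻¹' S =
        (fun y : E d => ε • y) ⁻¹' ((fun y => (1 - ε) • x + y) ⁻¹' S) := rfl
    rw [e, Measure.smul_apply, Measure.addHaar_preimage_smul _ hε.ne', measure_preimage_add,
      finrank_euclideanSpace_fin, Measure.smul_apply, smul_eq_mul, smul_eq_mul, mul_assoc]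
  have h1 : MemLp g 2 ((bumpLaw φ).map fun y => blend ε (x, y)) :=
    (hg.smul_measure (ENNReal.mul_ne_top hM ENNReal.ofReal_ne_top)).mono_measure hmap
  exact (h1.comp_of_map hc.aemeasurable).integrable one_le_two

/-- The rescaled kernel. -/
def kernel (ε : ℝ) (w : E d) : ℝ := (ε ^ d)⁻¹ * φ.normed volume (-(ε⁻¹ • w))

lemma contDiff_kernel (ε : ℝ) : ContDiff ℝ ∞ (kernel φ ε) := by
  have := φ.contDiff_normed (μ := volume) (n := ⊤)
  have h2 : ContDiff ℝ ∞ fun w : E d => -(ε⁻¹ • w) := by fun_prop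
  exact contDiff_const.mul (this.comp h2)

lemma hasCompactSupport_kernel {ε : ℝ} (hε : 0 < ε) : HasCompactSupport (kernel φ ε) := by
  have h := φ.hasCompactSupport_normed (μ := volume)
  have h2 : HasCompactSupport fun w : E d => φ.normed volume (-(ε⁻¹ • w)) :=
    h.comp_homeomorph ((Homeomorph.smulOfNeZero ε⁻¹ (inv_ne_zero hε.ne')).trans (Homeomorph.neg _))
  exact h2.mul_left

/-- The substitution z = (1-ε)x + εy shows the average as a convolution evaluated at (1-ε)x, which
supplies its smoothness and derivative. -/
lemma integral_blend_eq {F : Type*} [NormedAddCommGroup F] [NormedSpace ℝ F] (g : E d → F)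
    {ε : ℝ} (hε : 0 < ε) (x : E d) :
    ∫ y, g (blend ε (x, y)) ∂bumpLaw φ =
      ∫ z, kernel φ ε ((1 - ε) • x - z) • g z := by
  rw [integral_bumpLaw]
  have h1 := Measure.integral_comp_smul volume
    (fun y : E d => φ.normed volume (ε⁻¹ • y) • g ((1 - ε) • x + y)) ε
  simp only [inv_smul_smul₀ hε.ne'] at h1
  have e1 : ∀ y : E d, blend ε (x, y) = (1 - ε) • x + ε • y := fun _ => rfl
  simp only [e1]
  rw [h1, finrank_euclideanSpace_fin, abs_of_pos (by positivity), ← integral_smul]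
  conv_rhs => rw [← integral_add_left_eq_self _ ((1 - ε) • x)]
  congr 1
  funext y
  rw [smul_smul, kernel]
  simp

lemma contDiff_integral_blend {v : E d → ℝ} (hv : LocallyIntegrable v volume) {ε : ℝ}
    (hε : 0 < ε) : ContDiff ℝ ∞ fun x => ∫ y, v (blend ε (x, y)) ∂bumpLaw φ := by
  have h := (hasCompactSupport_kernel φ hε).contDiff_convolution_right
    (ContinuousLinearMap.mul ℝ ℝ) hv (n := ⊤) (contDiff_kernel φ ε)
  have h2 : ContDiff ℝ ∞ fun x : E d => (1 - ε) • x := by fun_prop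
  have h3 := h.comp h2
  convert h3 using 1
  funext x
  rw [integral_blend_eq φ v hε, Function.comp_apply, convolution_def]
  simp [mul_comm]

/-- The derivative falls on the kernel and the weak formulation moves it to v; the factor 1 - ε is
the chain rule. Convexity is what makes the kernel an admissible test function at every x in Ω. -/
lemma gradient_integral_blend {Ω : Set (E d)} (hΩ : Convex ℝ Ω)
    (hφ : Metric.closedBall c φ.rOut ⊆ Ω) {v : E d → ℝ} {G : E d → E d} (h : IsH1 Ω v G)
    (hv : MemLp v 2 volume) (hG : MemLp G 2 volume) (hv0 : ∀ x ∉ Ω, v x = 0)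
    (hG0 : ∀ x ∉ Ω, G x = 0) {ε : ℝ} (hε : ε ∈ Set.Ioc (0 : ℝ) 1) {x : E d} (hx : x ∈ Ω) :
    ∇ (fun x => ∫ y, v (blend ε (x, y)) ∂bumpLaw φ) x =
      (1 - ε) • ∫ y, G (blend ε (x, y)) ∂bumpLaw φ := by
  have hvl : LocallyIntegrable v volume := hv.locallyIntegrable one_le_two
  have hk := contDiff_kernel φ ε
  have hkc := hasCompactSupport_kernel φ hε.1
  have hk1 : ContDiff ℝ 1 (kernel φ ε) := hk.of_le (by exact_mod_cast le_top)
  set ξ := (1 - ε) • x with hξ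
  set Φ : E d → ℝ := fun z => kernel φ ε (ξ - z) with hΦ
  have hΦs : ContDiff ℝ ∞ Φ := hk.comp (by fun_prop)
  have hΦc : HasCompactSupport Φ := hkc.comp_homeomorph (Homeomorph.subLeft ξ)
  -- The support consists of points (1-ε)x + εy with y in the ball of the bump, all of which lie in
  -- Ω by convexity.
  have hsub : tsupport Φ ⊆ Ω := by
    have h1 : tsupport Φ ⊆ (fun y => blend ε (x, y)) '' Metric.closedBall c φ.rOut := by
      refine closure_minimal ?_ ((isCompact_closedBall c φ.rOut).image
        ((continuous_blend ε).comp (by fun_prop))).isClosed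
      intro z hz
      refine ⟨ε⁻¹ • (z - ξ), ?_, ?_⟩
      · rw [← φ.tsupport_normed_eq (μ := volume)]
        refine subset_tsupport _ fun h0 => hz ?_
        have : -(ε⁻¹ • (ξ - z)) = ε⁻¹ • (z - ξ) := by rw [← smul_neg, neg_sub]
        simp only [Φ, kernel, this, h0, mul_zero]
      · simp [blend, smul_inv_smul₀ hε.1.ne', ← hξ]
    rintro z hz
    obtain ⟨y, hy, rfl⟩ := h1 hz
    exact hΩ hx (hφ hy) (by linarith [hε.2]) hε.1.le (by ring)
  have hconv := hkc.hasFDerivAt_convolution_right (ContinuousLinearMap.mul ℝ ℝ) hvl hk1 ξ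
  have hlin : HasFDerivAt (fun x : E d => (1 - ε) • x)
      ((1 - ε) • ContinuousLinearMap.id ℝ (E d)) x :=
    (hasFDerivAt_id x).const_smul (1 - ε)
  have hcomp := hconv.comp x hlin
  have hfun : (fun x => ∫ y, v (blend ε (x, y)) ∂bumpLaw φ) =
      (convolution v (kernel φ ε) (ContinuousLinearMap.mul ℝ ℝ) volume) ∘
        fun x : E d => (1 - ε) • x := by
    funext x
    rw [integral_blend_eq φ v hε.1, Function.comp_apply, convolution_def]
    simp [mul_comm]
  rw [← hfun] at hcomp
  refine ext_inner_right ℝ fun e => ?_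
  rw [inner_gradient_left, hcomp.fderiv, ContinuousLinearMap.comp_apply,
    smul_apply, ContinuousLinearMap.id_apply, map_smul,
    convolution_precompR_apply _ hvl (hkc.fderiv ℝ) (hk1.continuous_fderiv one_ne_zero),
    inner_smul_left, smul_eq_mul, convolution_def]
  simp only [conj_trivial]
  congr 1
  have hGint : Integrable (fun z => kernel φ ε (ξ - z) • G z) volume := by
    have := (hG.locallyIntegrable one_le_two).integrable_smul_left_of_hasCompactSupport
      hΦs.continuous hΦc
    exact this
  rw [integral_blend_eq φ G hε.1, real_inner_comm, ← integral_inner hGint]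
  have hweak := h.integral_eq Φ hΦs hΦc hsub e
  have hfd : ∀ z, fderiv ℝ Φ z e = - fderiv ℝ (kernel φ ε) (ξ - z) e := by
    intro z
    have h1 := ((hk1.differentiable one_ne_zero) (ξ - z)).hasFDerivAt.comp z
      ((hasFDerivAt_id z).const_sub ξ)
    have h2 : fderiv ℝ Φ z = _ := h1.fderiv
    rw [h2]; simp
  rw [setIntegral_eq_integral_of_forall_compl_eq_zero (fun z hz => by simp [hv0 z hz]),
    setIntegral_eq_integral_of_forall_compl_eq_zero (fun z hz => by simp [hG0 z hz])] at hweak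
  simp only [hfd, mul_neg, integral_neg, neg_inj] at hweak
  simp only [ContinuousLinearMap.mul_apply', inner_smul_right]
  refine hweak.trans ?_
  congr 1
  funext z
  rw [mul_comm, real_inner_comm]

end bump

/-- Smooth functions are dense in `H¹` of a bounded convex open set. -/
theorem exists_smooth_tendsto {d : ℕ} {Ω : Set (E d)} (hΩ : Convex ℝ Ω) (hΩo : IsOpen Ω)
    (hΩne : Ω.Nonempty) (hΩb : Bornology.IsBounded Ω) {v : E d → ℝ} {G : E d → E d}
    (h : IsH1 Ω v G) : ∃ u : ℕ → E d → ℝ, (∀ n, ContDiff ℝ ∞ (u n)) ∧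
      Tendsto (fun n => eLpNorm (fun x => u n x - v x) 2 (volume.restrict Ω)) atTop (𝓝 0) ∧
      Tendsto (fun n => eLpNorm (fun x => ∇ (u n) x - G x) 2 (volume.restrict Ω))
        atTop (𝓝 0) := by
  have hm := hΩo.measurableSet
  -- Extension by zero alters nothing on Ω. The extension need not be weakly differentiable across
  -- the boundary, since gradients are only taken inside Ω.
  wlog h0 : (∀ x ∉ Ω, v x = 0) ∧ ∀ x ∉ Ω, G x = 0 generalizing v G
  · have hv : ∀ x ∈ Ω, Ω.indicator v x = v x := fun x hx => Set.indicator_of_mem hx v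
    have hG : ∀ x ∈ Ω, Ω.indicator G x = G x := fun x hx => Set.indicator_of_mem hx G
    have hv' : Ω.indicator v =ᵐ[volume.restrict Ω] v :=
      (ae_restrict_mem hm).mono fun x hx => hv x hx
    have hG' : Ω.indicator G =ᵐ[volume.restrict Ω] G :=
      (ae_restrict_mem hm).mono fun x hx => hG x hx
    have h1 : IsH1 Ω (Ω.indicator v) (Ω.indicator G) := by
      refine ⟨h.memLp.ae_eq hv'.symm, h.memLp_grad.ae_eq hG'.symm, fun φ h1 h2 h3 e => ?_⟩
      rw [setIntegral_congr_fun hm (g := fun x => v x * fderiv ℝ φ x e) fun x hx => by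
          simp only [hv x hx], h.integral_eq φ h1 h2 h3 e]
      congr 1
      exact setIntegral_congr_fun hm fun x hx => by simp only [hG x hx]
    obtain ⟨u, h2, h3, h4⟩ := this h1 ⟨fun x hx => Set.indicator_of_notMem hx v,
      fun x hx => Set.indicator_of_notMem hx G⟩
    refine ⟨u, h2, ?_, ?_⟩
    · refine h3.congr fun n => eLpNorm_congr_ae ?_
      filter_upwards [hv'] with x hx
      rw [hx]
    · refine h4.congr fun n => eLpNorm_congr_ae ?_
      filter_upwards [hG'] with x hx
      rw [hx]
  obtain ⟨hv0, hG0⟩ := h0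
  have hv : MemLp v 2 volume := by
    have := (memLp_indicator_iff_restrict hm).2 h.memLp
    rwa [Set.indicator_eq_self.2 fun x hx => by_contra fun h => hx (hv0 x h)] at this
  have hG : MemLp G 2 volume := by
    have := (memLp_indicator_iff_restrict hm).2 h.memLp_grad
    rwa [Set.indicator_eq_self.2 fun x hx => by_contra fun h => hx (hG0 x h)] at this
  obtain ⟨c, hc⟩ := hΩne
  obtain ⟨r, hr, hball⟩ := Metric.nhds_basis_closedBall.mem_iff.1 (hΩo.mem_nhds hc)
  let φ : ContDiffBump c := ⟨r / 2, r, by positivity, by linarith⟩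
  have hφ : Metric.closedBall c φ.rOut ⊆ Ω := hball
  obtain ⟨R, hR⟩ := hΩb.exists_norm_le
  set ε : ℕ → ℝ := fun n => 1 / ((n : ℝ) + 2)
  have hε0 : ∀ n, 0 < ε n := fun n => by positivity
  have hε2 : ∀ n, ε n ≤ 1 / 2 := fun n =>
    one_div_le_one_div_of_le two_pos (by linarith [(Nat.cast_nonneg n : (0 : ℝ) ≤ n)])
  have hεI : ∀ n, ε n ∈ Set.Icc (0 : ℝ) (1 / 2) := fun n => ⟨(hε0 n).le, hε2 n⟩
  have hεt : Tendsto ε atTop (𝓝 0) := by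
    have h1 : Tendsto (fun n : ℕ => (n : ℝ) + 2) atTop atTop :=
      tendsto_natCast_atTop_atTop.atTop_add tendsto_const_nhds
    exact tendsto_const_nhds.div_atTop h1
  have hν : ∀ᵐ y ∂bumpLaw φ, ‖y‖ ≤ R := (ae_bumpLaw φ).mono fun y hy => hR y (hφ hy)
  have tv := tendsto_eLpNorm_average hm hR hν hv hεI hεt
    fun n x => integrable_bumpLaw φ hv (hε0 n) x
  have tG := tendsto_eLpNorm_average hm hR hν hG hεI hεt
    fun n x => integrable_bumpLaw φ hG (hε0 n) x
  refine ⟨fun n x => ∫ y, v (blend (ε n) (x, y)) ∂bumpLaw φ,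
    fun n => contDiff_integral_blend φ (hv.locallyIntegrable one_le_two) (hε0 n), tv, ?_⟩
  -- On Ω the gradient error is (1-ε)(average of G - G) - εG.
  have hup : Tendsto (fun n => eLpNorm (fun x => ∫ y, G (blend (ε n) (x, y)) ∂bumpLaw φ - G x) 2
      (volume.restrict Ω) + ENNReal.ofReal (ε n) * eLpNorm G 2 (volume.restrict Ω))
      atTop (𝓝 0) := by
    have h1 : Tendsto (fun n => ENNReal.ofReal (ε n)) atTop (𝓝 0) := by
      simpa [Function.comp_def] using (ENNReal.continuous_ofReal.tendsto 0).comp hεt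
    have h2 := ENNReal.Tendsto.mul_const h1 (b := eLpNorm G 2 (volume.restrict Ω))
      (Or.inr h.memLp_grad.eLpNorm_ne_top)
    simpa using tG.add h2
  refine tendsto_of_tendsto_of_tendsto_of_le_of_le tendsto_const_nhds hup
    (fun n => zero_le) fun n => ?_
  set TG : E d → E d := fun x => ∫ y, G (blend (ε n) (x, y)) ∂bumpLaw φ with hTG
  have hTGm : AEStronglyMeasurable TG (volume.restrict Ω) := by
    have hac : ((volume.restrict Ω).prod (bumpLaw φ)).map (blend (ε n)) ≪ volume :=
      (Measure.absolutelyContinuous_of_le (map_blend_le Ω (hεI n))).trans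
        Measure.smul_absolutelyContinuous
    exact ((hG.aestronglyMeasurable.mono_ac hac).comp_measurable
      (continuous_blend _).measurable).integral_prod_right'
  have e1 : eLpNorm (fun x => ∇ (fun x => ∫ y, v (blend (ε n) (x, y)) ∂bumpLaw φ) x - G x) 2
      (volume.restrict Ω) = eLpNorm ((1 - ε n) • (fun x => TG x - G x) - ε n • G) 2
        (volume.restrict Ω) := by
    refine eLpNorm_congr_ae ((ae_restrict_mem hm).mono fun x hx => ?_)
    simp only [gradient_integral_blend φ hΩ hφ h hv hG hv0 hG0
      ⟨hε0 n, (hε2 n).trans (by norm_num)⟩ hx, Pi.sub_apply, Pi.smul_apply]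
    simp only [hTG, sub_smul, one_smul, smul_sub]
    abel
  rw [e1]
  have hsubm := hTGm.sub h.memLp_grad.aestronglyMeasurable
  refine (eLpNorm_sub_le (hsubm.const_smul (1 - ε n))
    (h.memLp_grad.aestronglyMeasurable.const_smul _) one_le_two).trans (add_le_add ?_ ?_)
  · rw [eLpNorm_const_smul]
    refine (mul_le_mul_left ?_ _).trans_eq (one_mul _)
    rw [← ofReal_norm, ← ENNReal.ofReal_one]
    refine ENNReal.ofReal_le_ofReal ?_
    rw [Real.norm_of_nonneg (by linarith [hε2 n])]
    linarith [hε0 n]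
  · rw [eLpNorm_const_smul, ← ofReal_norm, Real.norm_of_nonneg (hε0 n).le]

/-! ### The two measures in barycentric coordinates -/

lemma restrict_interior_eq {d : ℕ} {K : Set (E d)} (hK : Convex ℝ K) :
    (volume : Measure (E d)).restrict (interior K) = volume.restrict K :=
  Measure.restrict_congr_set (interior_ae_eq_of_null_frontier (hK.addHaar_frontier volume))

lemma convex_body {d : ℕ} (s : Affine.Simplex ℝ (E d) d) : Convex ℝ (body s) := by
  rw [body, ← s.convexHull_eq_closedInterior]
  exact convex_convexHull ℝ _

lemma smul_map_uniform_eq {n d : ℕ} {μ : Measure (E d)} {p : Fin (n + 1) → E d} {c : ENNReal}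
    (hc : c ≠ ⊤) (h : μ = c • (uniform n).map (bary p)) :
    μ = ENNReal.ofReal (μ Set.univ).toReal • (uniform n).map (bary p) := by
  have := isProbabilityMeasure_uniform n
  have h1 : IsProbabilityMeasure ((uniform n).map (bary p)) :=
    Measure.isProbabilityMeasure_map (continuous_bary p).aemeasurable
  have h2 : μ Set.univ = c := by rw [h]; simp
  rw [h2, ENNReal.ofReal_toReal hc]
  exact h

/-- The vertices are reordered so that the one opposite the facet comes last, as the conical
coordinates require; the first n + 1 then span the facet. -/
lemma exists_vertices {n : ℕ} (s : Affine.Simplex ℝ (E (n + 1)) (n + 1)) (i : Fin (n + 2)) :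
    ∃ p : Fin (n + 2) → E (n + 1), (∀ j k, dist (p j) (p k) ≤ diam s) ∧
      volume.restrict (interior (body s)) =
        ENNReal.ofReal (vol s) • (uniform (n + 1)).map (bary p) ∧
      surface (facet s i) =
        ENNReal.ofReal (area s i) • (uniform n).map (bary fun j => p j.castSucc) ∧
      0 < vol s ∧ 0 < area s i ∧ 0 < diam s := by
  let e : Fin (n + 2) ≃ Fin (n + 2) := finSuccEquivLast.trans (finSuccEquiv' i).symm
  have he : ∀ j : Fin (n + 1), e j.castSucc = i.succAbove j := fun j => by
    simp [e]
  have hind : AffineIndependent ℝ (s.points ∘ e) := s.independent.comp_embedding e.toEmbedding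
  have hindf : AffineIndependent ℝ fun j : Fin (n + 1) => (s.points ∘ e) j.castSucc :=
    hind.comp_embedding Fin.castSuccEmb
  have hbody : convexHull ℝ (Set.range (s.points ∘ e)) = body s := by
    rw [e.surjective.range_comp, s.convexHull_eq_closedInterior]
  have hfacet : convexHull ℝ (Set.range fun j : Fin (n + 1) => (s.points ∘ e) j.castSucc) =
      facet s i := by
    rw [facet, ← (s.faceOpposite i).convexHull_eq_closedInterior]
    congr 1
    rw [s.range_faceOpposite_points, ← Fin.range_succAbove, ← Set.range_comp]
    congr 1
    funext j
    simp [he]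
  obtain ⟨c, hc0, hc, h⟩ := exists_restrict_eq_smul_map hind
  obtain ⟨c', hc0', hc', h'⟩ := exists_restrict_eq_smul_map hindf
  rw [hbody, EuclideanSpace.euclideanHausdorffMeasure_eq_volume] at h
  rw [hfacet] at h'
  have hprob : ∀ (m : ℕ) (q : Fin (m + 1) → E (n + 1)),
      IsProbabilityMeasure ((uniform m).map (bary q)) := fun m q => by
    have := isProbabilityMeasure_uniform m
    exact Measure.isProbabilityMeasure_map (continuous_bary q).aemeasurable
  have hvol : vol s = ((volume : Measure (E (n + 1))).restrict (body s) Set.univ).toReal := by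
    rw [Measure.restrict_apply_univ, vol]
  refine ⟨s.points ∘ e, fun j k => ?_, ?_, smul_map_uniform_eq hc' h', ?_, ?_, ?_⟩
  · exact Metric.dist_le_diam_of_mem s.isCompact_closedInterior.isBounded
      (s.point_mem_closedInterior _) (s.point_mem_closedInterior _)
  · rw [hvol, restrict_interior_eq (convex_body s)]
    exact smul_map_uniform_eq hc h
  · rw [hvol, h]
    have := hprob _ (s.points ∘ e)
    simpa using ENNReal.toReal_pos hc0 hc
  · have h2 : surface (facet s i) = _ := h'
    rw [area, h2]
    have := hprob _ fun j : Fin (n + 1) => (s.points ∘ e) j.castSucc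
    simpa using ENNReal.toReal_pos hc0' hc'
  · have h01 : (0 : Fin (n + 2)) ≠ 1 := by simp
    exact (dist_pos.2 (s.independent.injective.ne h01)).trans_le
      (Metric.dist_le_diam_of_mem s.isCompact_closedInterior.isBounded
        (s.point_mem_closedInterior _) (s.point_mem_closedInterior _))

lemma integral_smul_map_uniform {n d : ℕ} {μ : Measure (E d)} {a : ℝ} (ha : 0 ≤ a)
    {p : Fin (n + 1) → E d} (h : μ = ENNReal.ofReal a • (uniform n).map (bary p))
    {f : E d → ℝ} (hf : Continuous f) :
    ∫ x, f x ∂μ = a * ∫ w, f (bary p w) ∂uniform n := by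
  rw [h, integral_smul_measure, ENNReal.toReal_ofReal ha, smul_eq_mul,
    integral_map (continuous_bary p).aemeasurable hf.aestronglyMeasurable]

lemma average_smul_map_uniform {n d : ℕ} {μ : Measure (E d)} {a : ℝ} (ha : 0 < a)
    {p : Fin (n + 1) → E d} (h : μ = ENNReal.ofReal a • (uniform n).map (bary p))
    {f : E d → ℝ} (hf : Continuous f) :
    ⨍ x, f x ∂μ = ∫ w, f (bary p w) ∂uniform n := by
  have := isProbabilityMeasure_uniform n
  have h1 : IsProbabilityMeasure ((uniform n).map (bary p)) :=
    Measure.isProbabilityMeasure_map (continuous_bary p).aemeasurable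
  have h2 : μ.real Set.univ = a := by
    rw [h, Measure.real, Measure.smul_apply, measure_univ, smul_eq_mul, mul_one,
      ENNReal.toReal_ofReal ha.le]
  rw [average_eq, h2, integral_smul_map_uniform ha.le h hf, smul_eq_mul,
    inv_mul_cancel_left₀ ha.ne']

lemma continuous_gradient {d : ℕ} {u : E d → ℝ} (hu : ContDiff ℝ 1 u) : Continuous (∇ u) :=
  (InnerProductSpace.toDual ℝ (E d)).symm.continuous.comp (hu.continuous_fderiv one_ne_zero)

lemma norm_gradient {d : ℕ} (u : E d → ℝ) (x : E d) : ‖∇ u x‖ = ‖fderiv ℝ u x‖ :=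
  (InnerProductSpace.toDual ℝ (E d)).symm.norm_map _

/-- Returns from mean values to integrals: a is the facet area, b the volume, m the dimension, which
produces the factor |γ|/(d|K|). -/
lemma sqrt_mul_le {a b m I X A : ℝ} (ha : 0 < a) (hb : 0 < b) (hX : 0 ≤ X) (hm : 0 < m)
    (h : I ≤ 1 / m * X * A) : √(a * I) ≤ √(a / (m * b) * X) * √(b * A) := by
  rw [← Real.sqrt_mul (by positivity)]
  refine Real.sqrt_le_sqrt ((mul_le_mul_of_nonneg_left h ha.le).trans_eq ?_)
  field_simp

/-! ### The two inequalities for smooth functions on the simplex. -/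

section smooth

variable {n : ℕ} (s : Affine.Simplex ℝ (E (n + 1)) (n + 1)) (i : Fin (n + 2)) {κ : ℝ}
  {u : E (n + 1) → ℝ}

lemma energyNorm_gradient_eq {p : Fin (n + 2) → E (n + 1)}
    (hV : volume.restrict (interior (body s)) =
        ENNReal.ofReal (vol s) • (uniform (n + 1)).map (bary p)) (hs : 0 < vol s)
    (hu : ContDiff ℝ 1 u) :
    energyNorm (interior (body s)) κ u (∇ u) =
      √(vol s * (∫ w, ‖fderiv ℝ u (bary p w)‖ ^ 2 ∂uniform (n + 1) +
          κ ^ 2 * ∫ w, u (bary p w) ^ 2 ∂uniform (n + 1))) := by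
  have hc := hu.continuous
  have hg := continuous_gradient hu
  have hfd := hu.continuous_fderiv one_ne_zero
  have hb := continuous_bary p
  rw [energyNorm, integral_smul_map_uniform hs.le hV (by fun_prop),
    integral_add (integrable_uniform _ (by fun_prop)) (integrable_uniform _ (by fun_prop)),
    integral_const_mul]
  simp only [norm_gradient]

theorem l2norm_le_of_contDiff (hκ : 0 < κ) (hu : ContDiff ℝ 1 u) :
    l2norm (surface (facet s i)) u ≤
      constT s i κ * energyNorm (interior (body s)) κ u (∇ u) := by
  obtain ⟨p, hp, hV, hS, hv, ha, hd⟩ := exists_vertices s i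
  have hc := hu.continuous
  rw [l2norm, integral_smul_map_uniform ha.le hS (by fun_prop),
    energyNorm_gradient_eq s hV hv hu, constT, mul_assoc (area s i / _)]
  refine sqrt_mul_le ha hv (by positivity) (by positivity) ?_
  have := integral_facet_sq_le_energy p hd hκ hp hu
  push_cast
  rwa [mul_assoc (1 / ((n : ℝ) + 1))] at this

theorem l2norm_sub_average_le_of_contDiff (hκ : 0 ≤ κ) (hu : ContDiff ℝ 1 u) :
    l2norm (surface (facet s i)) (fun x => u x - ⨍ y, u y ∂surface (facet s i)) ≤
      constTBar s i κ * energyNorm (interior (body s)) κ u (∇ u) := by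
  obtain ⟨p, hp, hV, hS, hv, ha, hd⟩ := exists_vertices s i
  have hc := hu.continuous
  have hm := minScale_pos hd hκ
  rw [l2norm, integral_smul_map_uniform ha.le hS (by fun_prop),
    average_smul_map_uniform ha hS hc,
    energyNorm_gradient_eq s hV hv hu, constTBar, mul_assoc (area s i / _)]
  refine sqrt_mul_le ha hv (by positivity) (by positivity) ?_
  have := integral_facet_sub_mean_sq_le p hd hκ hp hu
  push_cast
  rwa [mul_assoc (1 / ((n : ℝ) + 1))] at this

lemma constT_pos (hκ : 0 < κ) : 0 < constT s i κ := by
  obtain ⟨p, hp, hV, hS, hv, ha, hd⟩ := exists_vertices s i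
  have : 0 < (2 * diam s) ^ 2 := by positivity
  unfold constT
  positivity

lemma constTBar_pos (hκ : 0 ≤ κ) : 0 < constTBar s i κ := by
  obtain ⟨p, hp, hV, hS, hv, ha, hd⟩ := exists_vertices s i
  have := minScale_pos hd hκ
  unfold constTBar
  positivity

instance : IsFiniteMeasure (surface (facet s i)) := by
  obtain ⟨p, hp, hV, hS, hv, ha, hd⟩ := exists_vertices s i
  have := isProbabilityMeasure_uniform n
  constructor
  rw [hS, Measure.smul_apply, Measure.map_apply (continuous_bary _).measurable .univ]
  simp

instance : IsFiniteMeasure (volume.restrict (interior (body s))) := by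
  constructor
  rw [Measure.restrict_apply_univ]
  exact (measure_mono interior_subset).trans_lt s.isCompact_closedInterior.measure_lt_top

lemma memLp_surface (hu : Continuous u) : MemLp u 2 (surface (facet s i)) := by
  obtain ⟨C, hC⟩ := (s.faceOpposite i).isCompact_closedInterior.exists_bound_of_continuousOn
    hu.continuousOn
  exact .of_bound hu.aestronglyMeasurable C
    (ae_restrict_of_forall_mem (s.faceOpposite i).isClosed_closedInterior.measurableSet hC)

lemma memLp_interior {F : Type*} [NormedAddCommGroup F] [SecondCountableTopology F]
    {f : E (n + 1) → F} (hf : Continuous f) :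
    MemLp f 2 (volume.restrict (interior (body s))) := by
  obtain ⟨C, hC⟩ := s.isCompact_closedInterior.exists_bound_of_continuousOn hf.continuousOn
  exact .of_bound hf.aestronglyMeasurable C
    (ae_restrict_of_forall_mem isOpen_interior.measurableSet fun x hx => hC x (interior_subset hx))

end smooth

/-! ### Passage to the limit -/

section limits

variable {d : ℕ} {μ : Measure (E d)}

lemma integral_norm_sq_eq {F : Type*} [NormedAddCommGroup F] {f : E d → F} (hf : MemLp f 2 μ) :
    ∫ x, ‖f x‖ ^ 2 ∂μ = (eLpNorm f 2 μ).toReal ^ 2 := by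
  rw [← ENNReal.toReal_pow, eLpNorm_two_sq,
    integral_eq_lintegral_of_nonneg_ae (.of_forall fun _ => by positivity)
      (by exact hf.aestronglyMeasurable.norm.pow 2)]
  congr 1
  refine lintegral_congr fun x => ?_
  rw [ENNReal.ofReal_pow (norm_nonneg _), ofReal_norm]

lemma l2norm_eq {f : E d → ℝ} (hf : MemLp f 2 μ) : l2norm μ f = (eLpNorm f 2 μ).toReal := by
  have := integral_norm_sq_eq hf
  simp only [Real.norm_eq_abs, sq_abs] at this
  rw [l2norm, this, Real.sqrt_sq ENNReal.toReal_nonneg]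

lemma energyNorm_eq {Ω : Set (E d)} {v : E d → ℝ} {G : E d → E d}
    (hv : MemLp v 2 (volume.restrict Ω)) (hG : MemLp G 2 (volume.restrict Ω)) (κ : ℝ) :
    energyNorm Ω κ v G = √((eLpNorm G 2 (volume.restrict Ω)).toReal ^ 2 +
      κ ^ 2 * (eLpNorm v 2 (volume.restrict Ω)).toReal ^ 2) := by
  have h1 := integral_norm_sq_eq hv
  simp only [Real.norm_eq_abs, sq_abs] at h1
  rw [energyNorm, integral_add (hG.integrable_norm_pow two_ne_zero) (hv.integrable_sq.const_mul _),
    integral_const_mul, h1, integral_norm_sq_eq hG]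

lemma tendsto_toReal_eLpNorm {F : Type*} [NormedAddCommGroup F] {f : ℕ → E d → F} {g : E d → F}
    (hf : ∀ n, MemLp (f n) 2 μ) (hg : MemLp g 2 μ)
    (h : Tendsto (fun n => eLpNorm (fun x => f n x - g x) 2 μ) atTop (𝓝 0)) :
    Tendsto (fun n => (eLpNorm (f n) 2 μ).toReal) atTop (𝓝 (eLpNorm g 2 μ).toReal) := by
  have h1 : Tendsto (fun n => (hf n).toLp (f n)) atTop (𝓝 (hg.toLp g)) :=
    (Lp.tendsto_Lp_iff_tendsto_eLpNorm'' f hf g hg).2 h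
  simpa only [Lp.norm_toLp] using h1.norm

lemma tendsto_energyNorm {Ω : Set (E d)} {v : E d → ℝ} {G : E d → E d} {u : ℕ → E d → ℝ}
    {U : ℕ → E d → E d} (hu : ∀ n, MemLp (u n) 2 (volume.restrict Ω))
    (hU : ∀ n, MemLp (U n) 2 (volume.restrict Ω))
    (hv : MemLp v 2 (volume.restrict Ω)) (hG : MemLp G 2 (volume.restrict Ω))
    (h1 : Tendsto (fun n => eLpNorm (fun x => u n x - v x) 2 (volume.restrict Ω)) atTop (𝓝 0))
    (h2 : Tendsto (fun n => eLpNorm (fun x => U n x - G x) 2 (volume.restrict Ω)) atTop (𝓝 0))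
    (κ : ℝ) : Tendsto (fun n => energyNorm Ω κ (u n) (U n)) atTop (𝓝 (energyNorm Ω κ v G)) := by
  simp only [fun n => energyNorm_eq (hu n) (hU n) κ, energyNorm_eq hv hG κ]
  exact (((tendsto_toReal_eLpNorm hU hG h2).pow 2).add
    (((tendsto_toReal_eLpNorm hu hv h1).pow 2).const_mul _)).sqrt

/-- After normalising the measure, the second moment about c is the variance plus the squared
distance from c to the mean. -/
lemma l2norm_sub_average_le [IsFiniteMeasure μ] {f : E d → ℝ} (hf : MemLp f 2 μ) (c : ℝ) :
    l2norm μ (fun x => f x - ⨍ y, f y ∂μ) ≤ l2norm μ fun x => f x - c := by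
  refine Real.sqrt_le_sqrt ?_
  rcases eq_zero_or_neZero μ with rfl | h0
  · simp
  have hP := isProbabilityMeasureSMul (μ := μ)
  have hfi := hf.integrable one_le_two
  have hc : (μ Set.univ)⁻¹ ≠ ⊤ := ENNReal.inv_ne_top.2 (NeZero.ne _)
  have key := fun b => integral_sub_const_sq (hfi.smul_measure hc)
    (hf.integrable_sq.smul_measure hc) b
  have hpos : 0 < ((μ Set.univ)⁻¹).toReal :=
    ENNReal.toReal_pos (ENNReal.inv_ne_zero.2 (measure_ne_top _ _)) hc
  refine le_of_mul_le_mul_left ?_ hpos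
  rw [average]
  have h1 := key (∫ x, f x ∂(μ Set.univ)⁻¹ • μ)
  have h2 := key c
  rw [integral_smul_measure, smul_eq_mul] at h1 h2
  rw [h1, h2]
  nlinarith [sq_nonneg (∫ x, f x ∂(μ Set.univ)⁻¹ • μ - c)]

end limits

/-- Continuity of restriction to the facet in the H¹ norm. The value κ = 1 is arbitrary; any
positive one would serve. -/
lemma eLpNorm_le_ofReal_mul {n : ℕ} (s : Affine.Simplex ℝ (E (n + 1)) (n + 1)) (i : Fin (n + 2))
    {u : E (n + 1) → ℝ} (hu : ContDiff ℝ 1 u) :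
    eLpNorm u 2 (surface (facet s i)) ≤ ENNReal.ofReal (constT s i 1) *
      (eLpNorm u 2 (volume.restrict (interior (body s))) +
        eLpNorm (∇ u) 2 (volume.restrict (interior (body s)))) := by
  have hS := memLp_surface s i hu.continuous
  have hV := memLp_interior s hu.continuous
  have hG := memLp_interior s (continuous_gradient hu)
  have h := l2norm_le_of_contDiff s i one_pos hu
  rw [l2norm_eq hS, energyNorm_eq hV hG] at h
  have hT := constT_pos s i one_pos
  rw [← ENNReal.ofReal_toReal hS.eLpNorm_ne_top, ← ENNReal.ofReal_toReal hV.eLpNorm_ne_top,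
    ← ENNReal.ofReal_toReal hG.eLpNorm_ne_top, ← ENNReal.ofReal_add (by positivity) (by positivity),
    ← ENNReal.ofReal_mul hT.le]
  refine ENNReal.ofReal_le_ofReal (h.trans (mul_le_mul_of_nonneg_left ?_ hT.le))
  refine Real.sqrt_le_iff.2 ⟨by positivity, ?_⟩
  have h3 : 0 ≤ (eLpNorm u 2 (volume.restrict (interior (body s)))).toReal *
    (eLpNorm (∇ u) 2 (volume.restrict (interior (body s)))).toReal := by positivity
  nlinarith

lemma eLpNorm_sub_surface_le {n : ℕ} (s : Affine.Simplex ℝ (E (n + 1)) (n + 1)) (i : Fin (n + 2))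
    {v : E (n + 1) → ℝ} {G : E (n + 1) → E (n + 1)} (h : IsH1 (interior (body s)) v G)
    {u u' : E (n + 1) → ℝ} (hu : ContDiff ℝ 1 u) (hu' : ContDiff ℝ 1 u') :
    eLpNorm (fun x => u x - u' x) 2 (surface (facet s i)) ≤ ENNReal.ofReal (constT s i 1) *
      (eLpNorm (fun x => u x - v x) 2 (volume.restrict (interior (body s))) +
        eLpNorm (fun x => ∇ u x - G x) 2 (volume.restrict (interior (body s)))) +
      ENNReal.ofReal (constT s i 1) *
      (eLpNorm (fun x => u' x - v x) 2 (volume.restrict (interior (body s))) +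
        eLpNorm (fun x => ∇ u' x - G x) 2 (volume.restrict (interior (body s)))) := by
  have key : ∀ {F : Type} [NormedAddCommGroup F] {f g w : E (n + 1) → F}
      {μ : Measure (E (n + 1))}, AEStronglyMeasurable f μ → AEStronglyMeasurable g μ →
      AEStronglyMeasurable w μ → eLpNorm (fun x => f x - g x) 2 μ ≤
        eLpNorm (fun x => f x - w x) 2 μ + eLpNorm (fun x => g x - w x) 2 μ := by
    intro F _ f g w μ hf hg hw
    have := eLpNorm_sub_le (hf.sub hw) (hg.sub hw) one_le_two
    rwa [sub_sub_sub_cancel_right] at this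
  refine (eLpNorm_le_ofReal_mul s i (hu.sub hu')).trans ?_
  rw [← mul_add, add_add_add_comm]
  have hgr : ∇ (fun x => u x - u' x) = fun x => ∇ u x - ∇ u' x := by
    funext x
    simp only [gradient]
    rw [fderiv_fun_sub (hu.differentiable one_ne_zero x) (hu'.differentiable one_ne_zero x),
      map_sub]
  rw [hgr]
  gcongr
  · exact key hu.continuous.aestronglyMeasurable hu'.continuous.aestronglyMeasurable
      h.memLp.aestronglyMeasurable
  · exact key (continuous_gradient hu).aestronglyMeasurable
      (continuous_gradient hu').aestronglyMeasurable h.memLp_grad.aestronglyMeasurable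

/-! ### Existence and uniqueness of the trace, and its two bounds. -/

section trace

variable {n : ℕ} {s : Affine.Simplex ℝ (E (n + 1)) (n + 1)} {i : Fin (n + 2)}
  {v : E (n + 1) → ℝ} {G : E (n + 1) → E (n + 1)}

lemma tendsto_trace_bound {u : ℕ → E (n + 1) → ℝ}
    (h1 : Tendsto (fun k => eLpNorm (fun x => u k x - v x) 2
      (volume.restrict (interior (body s)))) atTop (𝓝 0))
    (h2 : Tendsto (fun k => eLpNorm (fun x => ∇ (u k) x - G x) 2
      (volume.restrict (interior (body s)))) atTop (𝓝 0)) :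
    Tendsto (fun k => ENNReal.ofReal (constT s i 1) *
      (eLpNorm (fun x => u k x - v x) 2 (volume.restrict (interior (body s))) +
        eLpNorm (fun x => ∇ (u k) x - G x) 2 (volume.restrict (interior (body s)))))
      atTop (𝓝 0) := by
  simpa using ENNReal.Tendsto.const_mul (h1.add h2) (Or.inr ENNReal.ofReal_ne_top)

theorem exists_isTrace (h : IsH1 (interior (body s)) v G) (i : Fin (n + 2)) :
    ∃ g, IsTrace (interior (body s)) (facet s i) v G g := by
  have hne : (interior (body s)).Nonempty := by
    obtain ⟨p, hp, hV, hS, hv, ha, hd⟩ := exists_vertices s i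
    rw [Set.nonempty_iff_ne_empty]
    intro h0
    have h3 := congrArg (fun μ : Measure (E (n + 1)) => (μ Set.univ).toReal)
      (restrict_interior_eq (convex_body s))
    simp only [Measure.restrict_apply_univ, h0, measure_empty, ENNReal.toReal_zero] at h3
    exact hv.ne h3
  obtain ⟨u, hu, h1, h2⟩ := exists_smooth_tendsto (convex_body s).interior isOpen_interior
    hne (s.isCompact_closedInterior.isBounded.subset interior_subset) h
  have hu1 : ∀ k, ContDiff ℝ 1 (u k) := fun k => (hu k).of_le (by exact_mod_cast le_top)
  have hS : ∀ k, MemLp (u k) 2 (surface (facet s i)) := fun k =>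
    memLp_surface s i (hu k).continuous
  have ht := tendsto_trace_bound (i := i) h1 h2
  -- Restriction is bounded on smooth functions, so convergence in H¹ forces the restrictions to be
  -- Cauchy in L²(γ), and completeness supplies the trace.
  have hcau : CauchySeq fun k => (hS k).toLp (u k) := by
    rw [EMetric.cauchySeq_iff]
    intro ε hε
    obtain ⟨N, hN⟩ := eventually_atTop.1 (ht.eventually_lt_const (ENNReal.half_pos hε.ne'))
    refine ⟨N, fun k hk l hl => ?_⟩
    rw [Lp.edist_toLp_toLp]
    refine (eLpNorm_sub_surface_le s i h (hu1 k) (hu1 l)).trans_lt ?_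
    exact (ENNReal.add_lt_add (hN k hk) (hN l hl)).trans_eq (ENNReal.add_halves ε)
  obtain ⟨g, hg⟩ := cauchySeq_tendsto_of_complete hcau
  refine ⟨g, Lp.memLp g, u, hu, h1, h2, ?_⟩
  refine (Lp.tendsto_Lp_iff_tendsto_eLpNorm'' u hS g (Lp.memLp g)).1 ?_
  rwa [Lp.toLp_coeFn]

theorem IsTrace.ae_eq (h : IsH1 (interior (body s)) v G) {g g' : E (n + 1) → ℝ}
    (hg : IsTrace (interior (body s)) (facet s i) v G g)
    (hg' : IsTrace (interior (body s)) (facet s i) v G g') :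
    g' =ᵐ[surface (facet s i)] g := by
  obtain ⟨hg2, u, hu, h1, h2, h3⟩ := hg
  obtain ⟨hg2', u', hu', h1', h2', h3'⟩ := hg'
  have hu1 : ∀ k, ContDiff ℝ 1 (u k) := fun k => (hu k).of_le (by exact_mod_cast le_top)
  have hu1' : ∀ k, ContDiff ℝ 1 (u' k) := fun k => (hu' k).of_le (by exact_mod_cast le_top)
  have ht := (h3'.add ((tendsto_trace_bound (i := i) h1' h2').add
    (tendsto_trace_bound (i := i) h1 h2))).add h3
  simp only [add_zero] at ht
  have h0 : eLpNorm (g' - g) 2 (surface (facet s i)) = 0 := by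
    refine le_antisymm (ge_of_tendsto' ht fun k => ?_) zero_le
    have m := (memLp_surface s i (hu k).continuous).aestronglyMeasurable
    have m' := (memLp_surface s i (hu' k).continuous).aestronglyMeasurable
    have e : g' - g = ((g' - u' k) + (u' k - u k)) + (u k - g) := by abel
    rw [e]
    refine (eLpNorm_add_le ((hg2'.aestronglyMeasurable.sub m').add (m'.sub m))
      (m.sub hg2.aestronglyMeasurable) one_le_two).trans (add_le_add ?_ le_rfl)
    refine (eLpNorm_add_le (hg2'.aestronglyMeasurable.sub m') (m'.sub m)
      one_le_two).trans (add_le_add ?_ (eLpNorm_sub_surface_le s i h (hu1' k) (hu1 k)))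
    rw [eLpNorm_sub_comm]
    rfl
  rw [eLpNorm_eq_zero_iff (hg2'.sub hg2).aestronglyMeasurable two_ne_zero] at h0
  filter_upwards [h0] with x hx
  exact sub_eq_zero.1 hx

theorem IsTrace.l2norm_le (h : IsH1 (interior (body s)) v G) {g : E (n + 1) → ℝ}
    (hg : IsTrace (interior (body s)) (facet s i) v G g) {κ : ℝ} (hκ : 0 < κ) :
    l2norm (surface (facet s i)) g ≤ constT s i κ * energyNorm (interior (body s)) κ v G := by
  obtain ⟨hg2, u, hu, h1, h2, h3⟩ := hg
  have hu1 : ∀ k, ContDiff ℝ 1 (u k) := fun k => (hu k).of_le (by exact_mod_cast le_top)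
  have hS := fun k => memLp_surface s i (hu k).continuous
  have hE := tendsto_energyNorm (fun k => memLp_interior s (hu k).continuous)
    (fun k => memLp_interior s (continuous_gradient (hu1 k))) h.memLp h.memLp_grad h1 h2 κ
  rw [l2norm_eq hg2]
  refine le_of_tendsto_of_tendsto' (tendsto_toReal_eLpNorm hS hg2 h3) (hE.const_mul _) fun k => ?_
  rw [← l2norm_eq (hS k)]
  exact l2norm_le_of_contDiff s i hκ (hu1 k)

theorem IsTrace.l2norm_sub_average_le (h : IsH1 (interior (body s)) v G) {g : E (n + 1) → ℝ}
    (hg : IsTrace (interior (body s)) (facet s i) v G g) {κ : ℝ} (hκ : 0 ≤ κ) :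
    l2norm (surface (facet s i)) (fun x => g x - ⨍ y, g y ∂surface (facet s i)) ≤
      constTBar s i κ * energyNorm (interior (body s)) κ v G := by
  obtain ⟨hg2, u, hu, h1, h2, h3⟩ := hg
  have hu1 : ∀ k, ContDiff ℝ 1 (u k) := fun k => (hu k).of_le (by exact_mod_cast le_top)
  have hS := fun k => memLp_surface s i (hu k).continuous
  have hE := tendsto_energyNorm (fun k => memLp_interior s (hu k).continuous)
    (fun k => memLp_interior s (continuous_gradient (hu1 k))) h.memLp h.memLp_grad h1 h2 κ
  have h4 := ((ENNReal.tendsto_toReal ENNReal.zero_ne_top).comp h3).add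
    (hE.const_mul (constTBar s i κ))
  rw [ENNReal.toReal_zero, zero_add] at h4
  refine ge_of_tendsto' h4 fun k => ?_
  -- The average of the approximation is used as a competitor for that of g. By minimality of the
  -- mean only u_k → g in L²(γ) is needed, and no convergence of averages.
  set m := ⨍ y, u k y ∂surface (facet s i)
  have hc : MemLp (fun _ : E (n + 1) => m) 2 (surface (facet s i)) := memLp_const m
  refine (SimplexTrace.l2norm_sub_average_le hg2 m).trans ?_
  refine le_trans ?_ (add_le_add_right (l2norm_sub_average_le_of_contDiff s i hκ (hu1 k)) _)
  have hum : MemLp (fun x => u k x - m) 2 (surface (facet s i)) := (hS k).sub hc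
  have hgm : MemLp (fun x => g x - m) 2 (surface (facet s i)) := hg2.sub hc
  have hug : MemLp (fun x => u k x - g x) 2 (surface (facet s i)) := (hS k).sub hg2
  rw [l2norm_eq hgm, l2norm_eq hum, Function.comp_apply,
    ← ENNReal.toReal_add hug.eLpNorm_ne_top hum.eLpNorm_ne_top]
  refine ENNReal.toReal_mono
    (ENNReal.add_ne_top.2 ⟨hug.eLpNorm_ne_top, hum.eLpNorm_ne_top⟩) ?_
  have e : (fun x => g x - m) = (g - u k) + fun x => u k x - m := by
    funext x
    simp
  rw [e]
  refine (eLpNorm_add_le (hg2.sub (hS k)).aestronglyMeasurable hum.aestronglyMeasurable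
    one_le_two).trans (add_le_add ?_ le_rfl)
  rw [eLpNorm_sub_comm]
  rfl

end trace

end SimplexTrace

end

theorem lemma1 (d : ℕ) [NeZero d] (s : Affine.Simplex ℝ (SimplexTrace.E d) d) (i : Fin (d + 1))
    (κ : ℝ) (hκ : 0 ≤ κ) :
    (0 < κ → 0 < SimplexTrace.constT s i κ) ∧ 0 < SimplexTrace.constTBar s i κ ∧
    ∀ (v : SimplexTrace.E d → ℝ) (G : SimplexTrace.E d → SimplexTrace.E d),
      SimplexTrace.IsH1 (interior (SimplexTrace.body s)) v G →
      ∃ g : SimplexTrace.E d → ℝ,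
        SimplexTrace.IsTrace (interior (SimplexTrace.body s)) (SimplexTrace.facet s i) v G g ∧
        (∀ g' : SimplexTrace.E d → ℝ,
          SimplexTrace.IsTrace (interior (SimplexTrace.body s)) (SimplexTrace.facet s i) v G g' →
          g' =ᵐ[SimplexTrace.surface (SimplexTrace.facet s i)] g) ∧
        (0 < κ → SimplexTrace.l2norm (SimplexTrace.surface (SimplexTrace.facet s i)) g ≤
          SimplexTrace.constT s i κ *
            SimplexTrace.energyNorm (interior (SimplexTrace.body s)) κ v G) ∧
        SimplexTrace.l2norm (SimplexTrace.surface (SimplexTrace.facet s i))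
            (fun x => g x - ⨍ y, g y ∂(SimplexTrace.surface (SimplexTrace.facet s i))) ≤
          SimplexTrace.constTBar s i κ *
            SimplexTrace.energyNorm (interior (SimplexTrace.body s)) κ v G := by
  obtain ⟨n, rfl⟩ := Nat.exists_eq_succ_of_ne_zero (NeZero.ne d)
  refine ⟨fun h => SimplexTrace.constT_pos s i h, SimplexTrace.constTBar_pos s i hκ,
    fun v G h => ?_⟩
  obtain ⟨g, hg⟩ := SimplexTrace.exists_isTrace h i
  exact ⟨g, hg, fun g' hg' => hg.ae_eq h hg', fun h0 => hg.l2norm_le h h0,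
    hg.l2norm_sub_average_le h hκ⟩
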